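/- A subset of $\mathbf{R}^n$ is called $\mathbf{Q}$-semialgebraic if it is a finite Boolean combination of sets $\{x\in\mathbf{R}^n : P(x)>0\}$ with $P\in\mathbf{Q}[x_1,\ldots,x_n]$. Let $\mathcal{P}\subset\mathbf{C}$ be the set of periods in the sense of Kontsevich and Zagier, that is, the complex numbers whose real and imaginary parts are values of absolutely convergent integrals $$\int_D \frac{P(x)}{Q(x)}\,dx_1\cdots dx_n,\qquad n\ge 0,\quad P,Q\in\mathbf{Q}[x_1,\ldots,x_n],\ Q\neq 0,\quad D\subset\mathbf{R}^n \text{ a } \mathbf{Q}\text{-semialgebraic set}.$$ Let $p\ge 2$ be an integer, let $a_1,\ldots,a_p$ and $b_1,\ldots,b_{p-1}$ be rational numbers such that no $b_i$ is an integer $\le 0$, and let $z\in\mathbf{C}$ be an algebraic number with $|z|<1$. Then the series $${}_pF_{p-1}\left({a_1,\ldots,a_p\atop b_1,\ldots,b_{p-1}}\ \Big|\ z\right)=\sum_{n=0}^{\infty}\frac{(a_1)_n\cdots(a_p)_n}{(b_1)_n\cdots(b_{p-1})_n}\cdot\frac{z^n}{n!},\qquad (x)_n=x(x+1)\cdots(x+n-1),$$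 converges absolutely, and its sum satisfies $${}_pF_{p-1}\left({a_1,\ldots,a_p\atop b_1,\ldots,b_{p-1}}\ \Big|\ z\right)\in\frac{1}{\pi^{p-1}}\,\mathcal{P}.$$ -/

import Mathlib

open MeasureTheory

/-- `ℚ`-semialgebraic subsets of `ℝⁿ`: the smallest family of subsets that contains the sets
`{x | 0 < P x}` with `P` a polynomial with rational coefficients and is closed under complements,
finite unions and finite intersections. -/
inductive IsRatSemialgebraic {n : ℕ} : Set (Fin n → ℝ) → Prop
  | pos (P : MvPolynomial (Fin n) ℚ) : IsRatSemialgebraic {x | 0 < MvPolynomial.aeval x P}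
  | compl {s : Set (Fin n → ℝ)} : IsRatSemialgebraic s → IsRatSemialgebraic sᶜ
  | union {s t : Set (Fin n → ℝ)} :
      IsRatSemialgebraic s → IsRatSemialgebraic t → IsRatSemialgebraic (s ∪ t)
  | inter {s t : Set (Fin n → ℝ)} :
      IsRatSemialgebraic s → IsRatSemialgebraic t → IsRatSemialgebraic (s ∩ t)

/-- Real periods: the values of absolutely convergent integrals (for Lebesgue measure) of rational
functions `P / Q` with rational coefficients over domains of some `ℝⁿ` that are given by polynomial
inequalities with rational coefficients. -/
def IsRealPeriod (r : ℝ) : Prop :=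
  ∃ (n : ℕ) (D : Set (Fin n → ℝ)) (P Q : MvPolynomial (Fin n) ℚ),
    IsRatSemialgebraic D ∧ Q ≠ 0 ∧
    IntegrableOn (fun x : Fin n → ℝ => MvPolynomial.aeval x P / MvPolynomial.aeval x Q) D volume ∧
    r = ∫ x in D, MvPolynomial.aeval x P / MvPolynomial.aeval x Q

/-- The set `𝒫` of periods of Kontsevich and Zagier: the complex numbers whose real and imaginary
parts are both real periods. -/
def kzPeriods : Set ℂ :=
  {w | IsRealPeriod w.re ∧ IsRealPeriod w.im}

/-- The `n`-th term `(a₁)ₙ ⋯ (aₚ)ₙ / ((b₁)ₙ ⋯ (b_q)ₙ) · zⁿ / n!` of the generalized hypergeometric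
series, where `(x)ₙ = x (x + 1) ⋯ (x + n - 1)`. -/
noncomputable def genHypergeometricTerm {p q : ℕ} (a : Fin p → ℂ) (b : Fin q → ℂ) (z : ℂ)
    (n : ℕ) : ℂ :=
  (∏ i, (ascPochhammer ℂ n).eval (a i)) / (∏ j, (ascPochhammer ℂ n).eval (b j)) *
    (z ^ n / (n.factorial : ℂ))

/-- The generalized hypergeometric function `pFq(a; b | z)`, as the sum of its series. -/
noncomputable def genHypergeometric {p q : ℕ} (a : Fin p → ℂ) (b : Fin q → ℂ) (z : ℂ) : ℂ :=
  ∑' n : ℕ, genHypergeometricTerm a b z n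

/-! The proof rests on a class of functions stable under integration: fibre volumes x ↦ vol {y | (x,
y) ∈ A} with A semialgebraic over ℚ (`IsVolumeFun`). Products of fibres give products, and Tonelli
gives integrals over parameters. Differences of two such functions, bounded on a set (`NiceOn`,
`NiceC`), form a ring. A constant in this ring is a difference of two finite volumes, and
`IsVolumeDiff.isRealPeriod` turns that into one integral of a polynomial. No projection of a
semialgebraic set is ever taken, so quantifier elimination is not needed.

The delicate point is that (1 - z T) ^ e belongs to the class for z algebraic, although it is
complex-valued and z is not rational. `NiceOn.newton_leibniz` handles this: F(x, V x) is F(x, q)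
with q rational, plus the integral of the derivative up to V x, and only the inequality v < V x has
to be semialgebraic over ℚ. It is used with V an algebraic constant (`NiceOn.algebraic`, and the two
coordinates of z in `NiceC.one_sub_cpow`) and with V the tangent of a fraction of an argument
(`NiceC.cpow`).

If 0 < a i < b i for every pair, expanding the binomial power and integrating termwise gives the
Euler integral (`integral_euler_eq`): the series times ∏ B(a i, b i - a i) is an integral of (1 - z
∏ t i) ^ (-c) against beta densities. By the reflection formula π / B is again a volume difference
(`isVolumeDiffC_pi_div_beta`), so each of the p - 1 pairs costs one factor π.

General parameters reduce to this case. Passing to a tail of the series makes all upper parameters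
positive (`isVolumeDiffC_hypSum_of_lt`), and a contiguity relation raises the lower parameters until
they exceed the upper ones (`hypSum_update`, `isVolumeDiffC_hypSum`). -/

open scoped ENNReal

/-! ### Polynomial functions and semialgebraic sets over ℚ -/

/-- Semialgebraic sets over `ℚ` in `ι → ℝ`, for an arbitrary index type. -/
inductive SemialgQ {ι : Type} : Set (ι → ℝ) → Prop
  | pos (P : MvPolynomial ι ℚ) : SemialgQ {x | 0 < MvPolynomial.aeval x P}
  | compl {s : Set (ι → ℝ)} : SemialgQ s → SemialgQ sᶜ
  | union {s t : Set (ι → ℝ)} : SemialgQ s → SemialgQ t → SemialgQ (s ∪ t)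
  | inter {s t : Set (ι → ℝ)} : SemialgQ s → SemialgQ t → SemialgQ (s ∩ t)

/-- Polynomial functions with rational coefficients. -/
def IsPolyFun {ι : Type} (f : (ι → ℝ) → ℝ) : Prop :=
  ∃ P : MvPolynomial ι ℚ, ∀ x, f x = MvPolynomial.aeval x P

namespace IsPolyFun

variable {ι : Type} {f g : (ι → ℝ) → ℝ}

theorem coord (i : ι) : IsPolyFun (fun x : ι → ℝ => x i) :=
  ⟨MvPolynomial.X i, fun x => by simp⟩

theorem const (q : ℚ) : IsPolyFun (fun _ : ι → ℝ => (q : ℝ)) :=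
  ⟨MvPolynomial.C q, fun x => by simp⟩

theorem zero : IsPolyFun (fun _ : ι → ℝ => (0 : ℝ)) := by
  simpa using const (ι := ι) 0

theorem one : IsPolyFun (fun _ : ι → ℝ => (1 : ℝ)) := by
  simpa using const (ι := ι) 1

theorem add (hf : IsPolyFun f) (hg : IsPolyFun g) : IsPolyFun (fun x => f x + g x) := by
  obtain ⟨P, hP⟩ := hf
  obtain ⟨Q, hQ⟩ := hg
  exact ⟨P + Q, fun x => by simp [hP, hQ]⟩

theorem mul (hf : IsPolyFun f) (hg : IsPolyFun g) : IsPolyFun (fun x => f x * g x) := by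
  obtain ⟨P, hP⟩ := hf
  obtain ⟨Q, hQ⟩ := hg
  exact ⟨P * Q, fun x => by simp [hP, hQ]⟩

theorem neg (hf : IsPolyFun f) : IsPolyFun (fun x => - f x) := by
  obtain ⟨P, hP⟩ := hf
  exact ⟨-P, fun x => by simp [hP]⟩

theorem sub (hf : IsPolyFun f) (hg : IsPolyFun g) : IsPolyFun (fun x => f x - g x) := by
  simpa [sub_eq_add_neg] using hf.add hg.neg

theorem pow (hf : IsPolyFun f) (n : ℕ) : IsPolyFun (fun x => f x ^ n) := by
  obtain ⟨P, hP⟩ := hf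
  exact ⟨P ^ n, fun x => by simp [hP]⟩

theorem prod {κ : Type} (s : Finset κ) {F : κ → (ι → ℝ) → ℝ} (h : ∀ k ∈ s, IsPolyFun (F k)) :
    IsPolyFun (fun x => ∏ k ∈ s, F k x) := by
  classical
  induction s using Finset.induction_on with
  | empty => simpa using one
  | insert a s ha ih =>
    simp only [Finset.prod_insert ha]
    exact (h a (by simp)).mul (ih fun k hk => h k (by simp [hk]))

theorem comp {κ : Type} (hf : IsPolyFun f) {φ : (κ → ℝ) → ι → ℝ}
    (hφ : ∀ i, IsPolyFun (fun x => φ x i)) : IsPolyFun (fun x => f (φ x)) := by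
  obtain ⟨P, hP⟩ := hf
  choose Q hQ using hφ
  refine ⟨MvPolynomial.bind₁ Q P, fun x => ?_⟩
  have : φ x = fun i => MvPolynomial.aeval x (Q i) := funext fun i => hQ i x
  simp only [hP, MvPolynomial.aeval_bind₁, this]

theorem measurable (hf : IsPolyFun f) [Countable ι] : Measurable f := by
  obtain ⟨P, hP⟩ := hf
  have : f = fun x => MvPolynomial.aeval x P := funext hP
  rw [this]
  simpa [MvPolynomial.eval_map, MvPolynomial.aeval_def] using
    (MvPolynomial.continuous_eval (P.map (algebraMap ℚ ℝ))).measurable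

end IsPolyFun

namespace SemialgQ

variable {ι : Type} {f g : (ι → ℝ) → ℝ} {p q : (ι → ℝ) → Prop}

theorem lt (hf : IsPolyFun f) (hg : IsPolyFun g) : SemialgQ {x | f x < g x} := by
  obtain ⟨P, hP⟩ := hg.sub hf
  have : {x | f x < g x} = {x | 0 < MvPolynomial.aeval x P} := by
    ext x; simp [← hP]
  rw [this]
  exact .pos P

theorem not (hp : SemialgQ {x | p x}) : SemialgQ {x | ¬ p x} := hp.compl

theorem and (hp : SemialgQ {x | p x}) (hq : SemialgQ {x | q x}) : SemialgQ {x | p x ∧ q x} :=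
  hp.inter hq

theorem or (hp : SemialgQ {x | p x}) (hq : SemialgQ {x | q x}) : SemialgQ {x | p x ∨ q x} :=
  hp.union hq

theorem le (hf : IsPolyFun f) (hg : IsPolyFun g) : SemialgQ {x | f x ≤ g x} := by
  simpa using (lt hg hf).not

theorem univ : SemialgQ (Set.univ : Set (ι → ℝ)) := by
  simpa using lt (ι := ι) IsPolyFun.zero IsPolyFun.one

theorem all {κ : Type} (s : Finset κ) {r : κ → (ι → ℝ) → Prop} (h : ∀ k, SemialgQ {x | r k x}) :
    SemialgQ {x | ∀ k ∈ s, r k x} := by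
  classical
  induction s using Finset.induction_on with
  | empty => simpa using univ
  | insert a s ha ih =>
    simp only [Finset.mem_insert, forall_eq_or_imp]
    exact (h a).and ih

theorem forall_fintype {κ : Type} [Fintype κ] {r : κ → (ι → ℝ) → Prop}
    (h : ∀ k, SemialgQ {x | r k x}) : SemialgQ {x | ∀ k, r k x} := by
  simpa using all Finset.univ h

theorem preimage {κ : Type} {s : Set (ι → ℝ)} (hs : SemialgQ s) {φ : (κ → ℝ) → ι → ℝ}
    (hφ : ∀ i, IsPolyFun (fun x => φ x i)) : SemialgQ {x | φ x ∈ s} := by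
  induction hs with
  | pos P => exact lt .zero (IsPolyFun.comp ⟨P, fun _ => rfl⟩ hφ)
  | compl _ ih => exact ih.compl
  | union _ _ ih1 ih2 => exact ih1.union ih2
  | inter _ _ ih1 ih2 => exact ih1.inter ih2

theorem measurableSet [Countable ι] {s : Set (ι → ℝ)} (hs : SemialgQ s) : MeasurableSet s := by
  induction hs with
  | pos P =>
    exact measurableSet_lt measurable_const (IsPolyFun.measurable ⟨P, fun _ => rfl⟩)
  | compl _ ih => exact ih.compl
  | union _ _ ih1 ih2 => exact ih1.union ih2
  | inter _ _ ih1 ih2 => exact ih1.inter ih2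

theorem isRatSemialgebraic {n : ℕ} {s : Set (Fin n → ℝ)} (hs : SemialgQ s) :
    IsRatSemialgebraic s := by
  induction hs with
  | pos P => exact .pos P
  | compl _ ih => exact .compl ih
  | union _ _ ih1 ih2 => exact .union ih1 ih2
  | inter _ _ ih1 ih2 => exact .inter ih1 ih2

end SemialgQ

/-! ### Fibre volumes of semialgebraic sets -/

theorem volume_sum_eq_lintegral {κ₁ κ₂ : Type} [Fintype κ₁] [Fintype κ₂] {s : Set (κ₁ ⊕ κ₂ → ℝ)}
    (hs : MeasurableSet s) :
    volume s = ∫⁻ y : κ₁ → ℝ, volume {w : κ₂ → ℝ | Sum.elim y w ∈ s} := by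
  have h := (volume_measurePreserving_sumPiEquivProdPi (fun _ : κ₁ ⊕ κ₂ => ℝ)).symm
  rw [← h.measure_preimage hs.nullMeasurableSet,
    Measure.volume_eq_prod, Measure.prod_apply (h.measurable hs)]
  rfl

theorem measurable_sumElim {κ₁ κ₂ : Type} :
    Measurable (fun z : (κ₁ → ℝ) × (κ₂ → ℝ) => (Sum.elim z.1 z.2 : κ₁ ⊕ κ₂ → ℝ)) := by
  refine measurable_pi_iff.2 fun i => ?_
  cases i
  · exact (measurable_pi_apply _).comp measurable_fst
  · exact (measurable_pi_apply _).comp measurable_snd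

theorem measurable_sumElim_right {κ₁ κ₂ : Type} (x : κ₁ → ℝ) :
    Measurable (fun w : κ₂ → ℝ => (Sum.elim x w : κ₁ ⊕ κ₂ → ℝ)) :=
  measurable_sumElim.comp measurable_prodMk_left

/-- Functions of the form `x ↦ vol {y | (x, y) ∈ A}` with `A` semialgebraic over `ℚ`. -/
def IsVolumeFun {ι : Type} (f : (ι → ℝ) → ℝ≥0∞) : Prop :=
  ∃ (κ : Type) (_ : Fintype κ) (A : Set (ι ⊕ κ → ℝ)),
    SemialgQ A ∧ ∀ x, f x = volume {y : κ → ℝ | Sum.elim x y ∈ A}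

theorem volume_sum_prod {κ₁ κ₂ : Type} [Fintype κ₁] [Fintype κ₂] (s : Set (κ₁ → ℝ))
    (t : Set (κ₂ → ℝ)) :
    volume {y : κ₁ ⊕ κ₂ → ℝ | y ∘ Sum.inl ∈ s ∧ y ∘ Sum.inr ∈ t} = volume s * volume t := by
  have h := volume_measurePreserving_sumPiEquivProdPi (fun _ : κ₁ ⊕ κ₂ => ℝ)
  rw [← Measure.prod_prod, ← Measure.volume_eq_prod]
  exact h.measure_preimage_equiv (s ×ˢ t)

theorem volume_unitCube (κ : Type) [Fintype κ] :
    volume {y : κ → ℝ | ∀ k, 0 < y k ∧ y k < 1} = 1 := by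
  have : {y : κ → ℝ | ∀ k, 0 < y k ∧ y k < 1} = Set.pi Set.univ fun _ => Set.Ioo (0 : ℝ) 1 := by
    ext; simp
  rw [this, volume_pi_pi]
  simp

theorem SemialgQ.unitCube {ι κ : Type} [Fintype κ] {φ : κ → ι} :
    SemialgQ {x : ι → ℝ | ∀ k, 0 < x (φ k) ∧ x (φ k) < 1} :=
  .forall_fintype fun _ => (SemialgQ.lt .zero (.coord _)).and (SemialgQ.lt (.coord _) .one)

namespace IsVolumeFun

variable {ι : Type} {f g : (ι → ℝ) → ℝ≥0∞}

theorem mul (hf : IsVolumeFun f) (hg : IsVolumeFun g) : IsVolumeFun (fun x => f x * g x) := by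
  obtain ⟨κ₁, _, A, hA, hfA⟩ := hf
  obtain ⟨κ₂, _, B, hB, hgB⟩ := hg
  refine ⟨κ₁ ⊕ κ₂, inferInstance, {w | Sum.elim (w ∘ Sum.inl) (w ∘ Sum.inr ∘ Sum.inl) ∈ A ∧
    Sum.elim (w ∘ Sum.inl) (w ∘ Sum.inr ∘ Sum.inr) ∈ B}, ?_, fun x => ?_⟩
  · refine (hA.preimage fun i => ?_).and (hB.preimage fun i => ?_) <;>
    · cases i <;> exact .coord _
  · change f x * g x = _
    rw [hfA, hgB, ← volume_sum_prod]
    rfl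

theorem comp (hf : IsVolumeFun f) {κ : Type} {φ : (κ → ℝ) → ι → ℝ}
    (hφ : ∀ i, IsPolyFun (fun x => φ x i)) : IsVolumeFun (fun x => f (φ x)) := by
  obtain ⟨κ₁, _, A, hA, hfA⟩ := hf
  refine ⟨κ₁, inferInstance, {w | Sum.elim (φ (w ∘ Sum.inl)) (w ∘ Sum.inr) ∈ A},
    hA.preimage fun i => ?_, fun x => hfA _⟩
  cases i with
  | inl i => exact (hφ i).comp fun j => .coord _
  | inr i => exact .coord _

theorem congr (hf : IsVolumeFun f) (h : ∀ x, g x = f x) : IsVolumeFun g := by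
  rwa [show g = f from funext h]

/-- Multiplying each fibre by a unit cube in the variables of the other leaves its volume unchanged
and puts both sets in the same space. -/
theorem exists_common (hf : IsVolumeFun f) (hg : IsVolumeFun g) :
    ∃ (κ : Type) (_ : Fintype κ) (A B : Set (ι ⊕ κ → ℝ)), SemialgQ A ∧ SemialgQ B ∧
      (∀ x, f x = volume {y : κ → ℝ | Sum.elim x y ∈ A}) ∧
      ∀ x, g x = volume {y : κ → ℝ | Sum.elim x y ∈ B} := by
  obtain ⟨κ₁, _, A, hA, hfA⟩ := hf
  obtain ⟨κ₂, _, B, hB, hgB⟩ := hg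
  refine ⟨κ₁ ⊕ κ₂, inferInstance,
    {w | Sum.elim (w ∘ Sum.inl) (w ∘ Sum.inr ∘ Sum.inl) ∈ A ∧
      ∀ k, 0 < w (.inr (.inr k)) ∧ w (.inr (.inr k)) < 1},
    {w | (∀ k, 0 < w (.inr (.inl k)) ∧ w (.inr (.inl k)) < 1) ∧
      Sum.elim (w ∘ Sum.inl) (w ∘ Sum.inr ∘ Sum.inr) ∈ B}, ?_, ?_, fun x => ?_, fun x => ?_⟩
  · refine (hA.preimage fun i => ?_).and .unitCube
    cases i <;> exact .coord _
  · refine SemialgQ.unitCube.and (hB.preimage fun i => ?_)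
    cases i <;> exact .coord _
  · rw [hfA, ← mul_one (volume _), ← volume_unitCube κ₂, ← volume_sum_prod]
    rfl
  · rw [hgB, ← one_mul (volume _), ← volume_unitCube κ₁, ← volume_sum_prod]
    rfl

theorem indicator {p : (ι → ℝ) → Prop} [DecidablePred p] (hp : SemialgQ {x | p x}) :
    IsVolumeFun (fun x => if p x then 1 else 0) := by
  refine ⟨Fin 0, inferInstance, {w | p (w ∘ Sum.inl)}, hp.preimage fun i => .coord _, fun x => ?_⟩
  have h : volume (Set.univ : Set (Fin 0 → ℝ)) = 1 := by simpa using volume_unitCube (Fin 0)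
  by_cases hx : p x <;> simp [hx, h]

theorem measurable [Finite ι] (hf : IsVolumeFun f) : Measurable f := by
  obtain ⟨κ₁, _, A, hA, hfA⟩ := hf
  rw [show f = _ from funext hfA]
  exact measurable_measure_prodMk_left (measurable_sumElim hA.measurableSet)

/-- By Tonelli, integrating fibre volumes over y yields the volume of the joint fibre in y and the
old fibre variables, cut out by the same set. -/
theorem lintegral [Finite ι] {κ : Type} [Fintype κ] {F : (ι ⊕ κ → ℝ) → ℝ≥0∞}
    (hF : IsVolumeFun F) :
    IsVolumeFun (fun x => ∫⁻ y : κ → ℝ, F (Sum.elim x y)) := by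
  obtain ⟨κ₁, _, A, hA, hfA⟩ := hF
  have hA' : SemialgQ {w : ι ⊕ (κ ⊕ κ₁) → ℝ |
      (Sum.elim (Sum.elim (w ∘ .inl) (w ∘ .inr ∘ .inl)) (w ∘ .inr ∘ .inr) : _ → ℝ) ∈ A} := by
    refine hA.preimage fun i => ?_
    rcases i with (i | i) | i <;> exact .coord _
  refine ⟨κ ⊕ κ₁, inferInstance, _, hA', fun x => ?_⟩
  rw [volume_sum_eq_lintegral]
  · simp only [hfA]
    rfl
  · exact measurable_sumElim_right x hA'.measurableSet

theorem lintegral_real [Finite ι] {F : (ι ⊕ Unit → ℝ) → ℝ≥0∞} (hF : IsVolumeFun F) :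
    IsVolumeFun (fun x => ∫⁻ v : ℝ, F (Sum.elim x fun _ => v)) := by
  refine hF.lintegral.congr fun x => ?_
  have h := (volume_preserving_funUnique Unit ℝ).symm
  rw [← h.lintegral_comp_emb (MeasurableEquiv.measurableEmbedding _)]
  rfl

/-- The two sets are placed in a common space and stacked over the disjoint unit intervals (0, 1)
and (1, 2) of an extra coordinate. -/
theorem add [Finite ι] (hf : IsVolumeFun f) (hg : IsVolumeFun g) :
    IsVolumeFun (fun x => f x + g x) := by
  classical
  obtain ⟨κ, _, A, B, hA, hB, hfA, hgB⟩ := hf.exists_common hg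
  have hS : SemialgQ {w : (ι ⊕ κ) ⊕ Unit → ℝ |
      ((0 < w (.inr ()) ∧ w (.inr ()) < 1) ∧ w ∘ .inl ∈ A) ∨
      ((1 < w (.inr ()) ∧ w (.inr ()) < 2) ∧ w ∘ .inl ∈ B)} := by
    refine SemialgQ.or
      (SemialgQ.and ((SemialgQ.lt .zero (.coord _)).and (SemialgQ.lt (.coord _) .one))
      (hA.preimage fun i => .coord _)) (SemialgQ.and ((SemialgQ.lt .one (.coord _)).and ?_)
      (hB.preimage fun i => .coord _))
    exact SemialgQ.lt (.coord _) (by simpa using IsPolyFun.const 2)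
  refine ((indicator hS).lintegral_real.lintegral (ι := ι)).congr fun x => ?_
  have hAm : MeasurableSet {y : κ → ℝ | Sum.elim x y ∈ A} :=
    measurable_sumElim_right x hA.measurableSet
  have hBm : MeasurableSet {y : κ → ℝ | Sum.elim x y ∈ B} :=
    measurable_sumElim_right x hB.measurableSet
  rw [hfA, hgB, ← lintegral_indicator_one hAm, ← lintegral_indicator_one hBm,
    ← lintegral_add_left (measurable_one.indicator hAm)]
  refine lintegral_congr fun y => ?_
  have key : ∀ v : ℝ, (if (Sum.elim (Sum.elim x y) (fun _ : Unit => v)) ∈ {w : (ι ⊕ κ) ⊕ Unit → ℝ |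
      ((0 < w (.inr ()) ∧ w (.inr ()) < 1) ∧ w ∘ .inl ∈ A) ∨
      ((1 < w (.inr ()) ∧ w (.inr ()) < 2) ∧ w ∘ .inl ∈ B)} then (1 : ℝ≥0∞) else 0) =
      (Set.Ioo (0 : ℝ) 1).indicator (fun _ => Set.indicator {y | Sum.elim x y ∈ A} 1 y) v +
      (Set.Ioo (1 : ℝ) 2).indicator (fun _ => Set.indicator {y | Sum.elim x y ∈ B} 1 y) v := by
    intro v
    by_cases hA1 : Sum.elim x y ∈ A <;> by_cases hB1 : Sum.elim x y ∈ B <;>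
      by_cases h1 : 0 < v ∧ v < 1 <;> by_cases h2 : 1 < v ∧ v < 2 <;>
      simp [Set.indicator, hA1, hB1, h1, h2] <;> linarith [h1.1, h1.2, h2.1, h2.2]
  refine Eq.trans ?_ (lintegral_congr key).symm
  rw [lintegral_add_left (measurable_const.indicator measurableSet_Ioo),
    lintegral_indicator_const measurableSet_Ioo, lintegral_indicator_const measurableSet_Ioo]
  norm_num

/-- A nonnegative function with semialgebraic hypograph is a volume function. -/
theorem ofReal_of_hypograph [Finite ι] {h : (ι → ℝ) → ℝ}
    (hh : SemialgQ {w : ι ⊕ Unit → ℝ | 0 < w (.inr ()) ∧ w (.inr ()) < h (w ∘ .inl)}) :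
    IsVolumeFun (fun x => ENNReal.ofReal (h x)) := by
  classical
  refine (indicator hh).lintegral_real.congr fun x => ?_
  have : ∀ v : ℝ, (if (Sum.elim x (fun _ : Unit => v)) ∈ {w : ι ⊕ Unit → ℝ |
      0 < w (.inr ()) ∧ w (.inr ()) < h (w ∘ .inl)} then (1 : ℝ≥0∞) else 0) =
      (Set.Ioo 0 (h x)).indicator 1 v := by
    intro v
    by_cases hv : 0 < v ∧ v < h x <;> simp [Set.indicator, hv]
  refine Eq.trans ?_ (lintegral_congr this).symm
  rw [lintegral_indicator_one measurableSet_Ioo]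
  simp

theorem ofReal_poly [Finite ι] {h : (ι → ℝ) → ℝ} (hh : IsPolyFun h) :
    IsVolumeFun (fun x => ENNReal.ofReal (h x)) :=
  ofReal_of_hypograph ((SemialgQ.lt .zero (.coord _)).and
    (SemialgQ.lt (.coord _) (hh.comp fun _ => .coord _)))

theorem const_one : IsVolumeFun (fun _ : ι → ℝ => 1) := by
  simpa using indicator (p := fun _ : ι → ℝ => True) (by simpa using SemialgQ.univ)

theorem prod {κ : Type} (s : Finset κ) {F : κ → (ι → ℝ) → ℝ≥0∞} (h : ∀ k, IsVolumeFun (F k)) :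
    IsVolumeFun (fun x => ∏ k ∈ s, F k x) := by
  classical
  induction s using Finset.induction_on with
  | empty => simpa using const_one
  | insert a s ha ih =>
    simp only [Finset.prod_insert ha]
    exact (h a).mul ih

/-- Rational powers of positive polynomial functions. -/
theorem ofReal_rpow [Finite ι] {h : (ι → ℝ) → ℝ} (hh : IsPolyFun h) (e : ℚ) :
    IsVolumeFun (fun x => ENNReal.ofReal (if 0 < h x then h x ^ (e : ℝ) else 0)) := by
  refine ofReal_of_hypograph ?_
  have hh' : IsPolyFun (fun w : ι ⊕ Unit → ℝ => h (w ∘ .inl)) := hh.comp fun i => .coord _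
  -- The inequality v < a ^ e is raised to the power `e.den`, and the positive and negative parts of
  -- `e.num` go to opposite sides, so that only natural exponents remain.
  have hS : SemialgQ {w : ι ⊕ Unit → ℝ | 0 < h (w ∘ .inl) ∧ 0 < w (.inr ()) ∧
      w (.inr ()) ^ e.den * h (w ∘ .inl) ^ (-e.num).toNat < h (w ∘ .inl) ^ e.num.toNat} :=
    (SemialgQ.lt .zero hh').and ((SemialgQ.lt .zero (.coord _)).and
      (SemialgQ.lt (((IsPolyFun.coord _).pow _).mul (hh'.pow _)) (hh'.pow _)))
  convert hS using 1
  ext w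
  simp only [Set.mem_ofPred_eq]
  set a := h (w ∘ .inl)
  set v := w (.inr ())
  by_cases ha : 0 < a
  · simp only [ha, if_true, true_and]
    refine and_congr_right fun hv => ?_
    have hd : e.den ≠ 0 := e.den_ne_zero
    have h1 : (a ^ (e : ℝ)) ^ e.den = a ^ e.num := by
      rw [← Real.rpow_natCast, ← Real.rpow_mul ha.le, ← Real.rpow_intCast]
      congr 1
      exact_mod_cast Rat.mul_den_eq_num e
    rw [← pow_lt_pow_iff_left₀ hv.le (by positivity) hd, h1]
    have h2 : a ^ e.num = a ^ e.num.toNat / a ^ (-e.num).toNat := by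
      rw [← zpow_natCast, ← zpow_natCast, ← zpow_sub₀ ha.ne', Int.toNat_sub_toNat_neg]
    rw [h2, lt_div_iff₀ (by positivity)]
  · simp only [ha, if_false, false_and, iff_false]
    rintro ⟨h1, h2⟩
    linarith

end IsVolumeFun

/-! ### The ring of differences of bounded volume functions -/

/-- On `S`, the function `f` is a difference of two bounded volume functions. -/
def NiceOn {ι : Type} (S : Set (ι → ℝ)) (f : (ι → ℝ) → ℝ) : Prop :=
  ∃ (f₁ f₂ : (ι → ℝ) → ℝ≥0∞) (C : ℝ≥0∞), IsVolumeFun f₁ ∧ IsVolumeFun f₂ ∧ C ≠ ∞ ∧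
    ∀ x ∈ S, f₁ x ≤ C ∧ f₂ x ≤ C ∧ f x = (f₁ x).toReal - (f₂ x).toReal

namespace NiceOn

variable {ι : Type} {S : Set (ι → ℝ)} {f g : (ι → ℝ) → ℝ}

theorem mono (hf : NiceOn S f) {T : Set (ι → ℝ)} (h : T ⊆ S) : NiceOn T f := by
  obtain ⟨f₁, f₂, C, h1, h2, hC, hf⟩ := hf
  exact ⟨f₁, f₂, C, h1, h2, hC, fun x hx => hf x (h hx)⟩

theorem congr (hf : NiceOn S f) (h : ∀ x ∈ S, g x = f x) : NiceOn S g := by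
  obtain ⟨f₁, f₂, C, h1, h2, hC, hf⟩ := hf
  exact ⟨f₁, f₂, C, h1, h2, hC, fun x hx => by rw [h x hx]; exact hf x hx⟩

theorem neg (hf : NiceOn S f) : NiceOn S (fun x => - f x) := by
  obtain ⟨f₁, f₂, C, h1, h2, hC, hf⟩ := hf
  refine ⟨f₂, f₁, C, h2, h1, hC, fun x hx => ?_⟩
  obtain ⟨a, b, c⟩ := hf x hx
  exact ⟨b, a, by simp only [c]; ring⟩

theorem add [Finite ι] (hf : NiceOn S f) (hg : NiceOn S g) : NiceOn S (fun x => f x + g x) := by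
  obtain ⟨f₁, f₂, C, h1, h2, hC, hf⟩ := hf
  obtain ⟨g₁, g₂, D, k1, k2, hD, hg⟩ := hg
  refine ⟨_, _, C + D, h1.add k1, h2.add k2, ENNReal.add_ne_top.2 ⟨hC, hD⟩, fun x hx => ?_⟩
  obtain ⟨a, b, c⟩ := hf x hx
  obtain ⟨a', b', c'⟩ := hg x hx
  refine ⟨add_le_add a a', add_le_add b b', ?_⟩
  rw [ENNReal.toReal_add (ne_top_of_le_ne_top hC a) (ne_top_of_le_ne_top hD a'),
    ENNReal.toReal_add (ne_top_of_le_ne_top hC b) (ne_top_of_le_ne_top hD b')]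
  simp only [c, c']
  ring

theorem sub [Finite ι] (hf : NiceOn S f) (hg : NiceOn S g) : NiceOn S (fun x => f x - g x) := by
  simpa [sub_eq_add_neg] using hf.add hg.neg

theorem mul [Finite ι] (hf : NiceOn S f) (hg : NiceOn S g) : NiceOn S (fun x => f x * g x) := by
  obtain ⟨f₁, f₂, C, h1, h2, hC, hf⟩ := hf
  obtain ⟨g₁, g₂, D, k1, k2, hD, hg⟩ := hg
  refine ⟨_, _, C * D + C * D, (h1.mul k1).add (h2.mul k2), (h1.mul k2).add (h2.mul k1),
    by finiteness, fun x hx => ?_⟩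
  obtain ⟨a, b, c⟩ := hf x hx
  obtain ⟨a', b', c'⟩ := hg x hx
  refine ⟨by gcongr, by gcongr, ?_⟩
  have e1 := ne_top_of_le_ne_top hC a
  have e2 := ne_top_of_le_ne_top hC b
  have e3 := ne_top_of_le_ne_top hD a'
  have e4 := ne_top_of_le_ne_top hD b'
  rw [ENNReal.toReal_add (by finiteness) (by finiteness),
    ENNReal.toReal_add (by finiteness) (by finiteness)]
  simp only [c, c', ENNReal.toReal_mul]
  ring

theorem comp (hf : NiceOn S f) {κ : Type} {φ : (κ → ℝ) → ι → ℝ} {T : Set (κ → ℝ)}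
    (hφ : ∀ i, IsPolyFun (fun x => φ x i)) (hT : ∀ x ∈ T, φ x ∈ S) :
    NiceOn T (fun x => f (φ x)) := by
  obtain ⟨f₁, f₂, C, h1, h2, hC, hf⟩ := hf
  exact ⟨_, _, C, h1.comp hφ, h2.comp hφ, hC, fun x hx => hf _ (hT x hx)⟩

theorem poly [Finite ι] (hf : IsPolyFun f) (M : ℝ) (hM : ∀ x ∈ S, |f x| ≤ M) : NiceOn S f := by
  refine ⟨_, _, ENNReal.ofReal M, .ofReal_poly hf, .ofReal_poly hf.neg, by finiteness,
    fun x hx => ⟨?_, ?_, ?_⟩⟩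
  · exact ENNReal.ofReal_le_ofReal ((le_abs_self _).trans (hM x hx))
  · exact ENNReal.ofReal_le_ofReal ((neg_le_abs _).trans (hM x hx))
  · rcases le_total 0 (f x) with h | h
    · rw [ENNReal.toReal_ofReal h, ENNReal.ofReal_of_nonpos (by linarith)]; simp
    · rw [ENNReal.ofReal_of_nonpos h, ENNReal.toReal_ofReal (by linarith)]; simp

theorem const [Finite ι] (q : ℚ) : NiceOn S (fun _ => (q : ℝ)) :=
  poly (.const q) |(q : ℝ)| fun _ _ => le_rfl

theorem one [Finite ι] : NiceOn S (fun _ => (1 : ℝ)) := by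
  simpa using const (S := S) 1

theorem zero [Finite ι] : NiceOn S (fun _ => (0 : ℝ)) := by
  simpa using const (S := S) 0

/-- The lower bound δ controls negative exponents and M the others; adding both powers gives one
bound for either sign of e. -/
theorem rpow [Finite ι] (hf : IsPolyFun f) {δ M : ℝ} (hδ : 0 < δ)
    (hM : ∀ x ∈ S, δ ≤ f x ∧ f x ≤ M) (e : ℚ) : NiceOn S (fun x => f x ^ (e : ℝ)) := by
  refine ⟨_, fun _ => ENNReal.ofReal 0, ENNReal.ofReal (δ ^ (e : ℝ) + M ^ (e : ℝ)),
    .ofReal_rpow hf e, .ofReal_poly .zero, by finiteness, fun x hx => ?_⟩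
  obtain ⟨h1, h2⟩ := hM x hx
  have h0 : 0 < f x := hδ.trans_le h1
  have hM0 : 0 < M := h0.trans_le h2
  have p1 : 0 < δ ^ (e : ℝ) := Real.rpow_pos_of_pos hδ _
  have p2 : 0 < M ^ (e : ℝ) := Real.rpow_pos_of_pos hM0 _
  simp only [h0, if_true, ENNReal.ofReal_zero, zero_le, true_and, ENNReal.toReal_zero, sub_zero]
  refine ⟨ENNReal.ofReal_le_ofReal ?_, (ENNReal.toReal_ofReal (by positivity)).symm⟩
  rcases le_total 0 (e : ℝ) with he | he
  · linarith [Real.rpow_le_rpow h0.le h2 he]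
  · linarith [Real.rpow_le_rpow_of_nonpos hδ h1 he]

/-- Integration over semialgebraic fibres against a weight. -/
theorem setIntegral [Finite ι] {κ : Type} [Fintype κ] {H : Set (ι ⊕ κ → ℝ)} (hH : SemialgQ H)
    {F : (ι ⊕ κ → ℝ) → ℝ} (hF : NiceOn {w | w ∘ .inl ∈ S ∧ w ∈ H} F)
    {G : (ι ⊕ κ → ℝ) → ℝ≥0∞} (hG : IsVolumeFun G) {D : ℝ≥0∞} (hD : D ≠ ∞)
    (hGD : ∀ x ∈ S, ∫⁻ y in {y : κ → ℝ | Sum.elim x y ∈ H}, G (Sum.elim x y) ≤ D) :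
    (∀ x ∈ S, IntegrableOn (fun y : κ → ℝ => (G (Sum.elim x y)).toReal * F (Sum.elim x y))
      {y | Sum.elim x y ∈ H}) ∧
    NiceOn S (fun x => ∫ y in {y : κ → ℝ | Sum.elim x y ∈ H},
      (G (Sum.elim x y)).toReal * F (Sum.elim x y)) := by
  classical
  -- The weight G may be unbounded, as beta densities are near the faces of the cube: only its
  -- integral over each fibre is controlled, while the two parts of F are bounded by C.
  obtain ⟨f₁, f₂, C, h1, h2, hC, hf⟩ := hF
  have hm : ∀ x, MeasurableSet {y : κ → ℝ | Sum.elim x y ∈ H} := fun x =>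
    measurable_sumElim_right x hH.measurableSet
  have key : ∀ (φ : (ι ⊕ κ → ℝ) → ℝ≥0∞), ∀ x,
      ∫⁻ y : κ → ℝ, (if Sum.elim x y ∈ H then 1 else 0) * (G (Sum.elim x y) * φ (Sum.elim x y)) =
      ∫⁻ y in {y : κ → ℝ | Sum.elim x y ∈ H}, G (Sum.elim x y) * φ (Sum.elim x y) := by
    intro φ x
    rw [← lintegral_indicator (hm x)]
    refine lintegral_congr fun y => ?_
    by_cases hy : Sum.elim x y ∈ H <;> simp [Set.indicator, hy]
  have bound : ∀ (φ : (ι ⊕ κ → ℝ) → ℝ≥0∞), (∀ w, w ∘ .inl ∈ S ∧ w ∈ H → φ w ≤ C) → ∀ x ∈ S,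
      ∫⁻ y in {y : κ → ℝ | Sum.elim x y ∈ H}, G (Sum.elim x y) * φ (Sum.elim x y) ≤ D * C := by
    intro φ hφ x hx
    calc _ ≤ ∫⁻ y in {y : κ → ℝ | Sum.elim x y ∈ H}, G (Sum.elim x y) * C :=
          setLIntegral_mono' (hm x) fun y hy => by
            gcongr
            exact hφ _ ⟨by simpa using hx, hy⟩
      _ = (∫⁻ y in {y : κ → ℝ | Sum.elim x y ∈ H}, G (Sum.elim x y)) * C :=
          lintegral_mul_const' _ _ hC
      _ ≤ D * C := by gcongr; exact hGD x hx
  have b1 := bound f₁ fun w hw => (hf w hw).1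
  have b2 := bound f₂ fun w hw => (hf w hw).2.1
  have m1 : ∀ x, AEMeasurable (fun y : κ → ℝ => G (Sum.elim x y) * f₁ (Sum.elim x y))
      (volume.restrict {y : κ → ℝ | Sum.elim x y ∈ H}) := fun x =>
    ((hG.mul h1).measurable.comp (measurable_sumElim_right x)).aemeasurable
  have m2 : ∀ x, AEMeasurable (fun y : κ → ℝ => G (Sum.elim x y) * f₂ (Sum.elim x y))
      (volume.restrict {y : κ → ℝ | Sum.elim x y ∈ H}) := fun x =>
    ((hG.mul h2).measurable.comp (measurable_sumElim_right x)).aemeasurable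
  have hDC : D * C ≠ ∞ := by finiteness
  have eqn : ∀ x ∈ S, ∀ y ∈ {y : κ → ℝ | Sum.elim x y ∈ H},
      (G (Sum.elim x y) * f₁ (Sum.elim x y)).toReal -
      (G (Sum.elim x y) * f₂ (Sum.elim x y)).toReal =
      (G (Sum.elim x y)).toReal * F (Sum.elim x y) := by
    intro x hx y hy
    rw [(hf (Sum.elim x y) ⟨by simpa using hx, hy⟩).2.2]
    simp only [ENNReal.toReal_mul]
    ring
  have i1 : ∀ x ∈ S, Integrable (fun y : κ → ℝ => (G (Sum.elim x y) * f₁ (Sum.elim x y)).toReal)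
      (volume.restrict {y : κ → ℝ | Sum.elim x y ∈ H}) := fun x hx =>
    integrable_toReal_of_lintegral_ne_top (m1 x) (ne_top_of_le_ne_top hDC (b1 x hx))
  have i2 : ∀ x ∈ S, Integrable (fun y : κ → ℝ => (G (Sum.elim x y) * f₂ (Sum.elim x y)).toReal)
      (volume.restrict {y : κ → ℝ | Sum.elim x y ∈ H}) := fun x hx =>
    integrable_toReal_of_lintegral_ne_top (m2 x) (ne_top_of_le_ne_top hDC (b2 x hx))
  refine ⟨fun x hx => ?_, _, _, D * C,
    ((IsVolumeFun.indicator (p := (· ∈ H)) hH).mul (hG.mul h1)).lintegral,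
    ((IsVolumeFun.indicator (p := (· ∈ H)) hH).mul (hG.mul h2)).lintegral, hDC, fun x hx => ?_⟩
  · exact IntegrableOn.congr_fun ((i1 x hx).sub (i2 x hx)) (eqn x hx) (hm x)
  · rw [key, key]
    refine ⟨b1 x hx, b2 x hx, ?_⟩
    beta_reduce
    rw [← setIntegral_congr_fun (hm x) (eqn x hx), integral_sub (i1 x hx) (i2 x hx),
      integral_toReal (m1 x) (ae_lt_top' (m1 x) (ne_top_of_le_ne_top hDC (b1 x hx))),
      integral_toReal (m2 x) (ae_lt_top' (m2 x) (ne_top_of_le_ne_top hDC (b2 x hx)))]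

/-- Composition with a function with semialgebraic hypograph, by the Newton–Leibniz formula. -/
theorem newton_leibniz [Finite ι] {V : (ι → ℝ) → ℝ} {q : ℚ} {M : ℝ} {H : Set (ι ⊕ Unit → ℝ)}
    (hH : SemialgQ H)
    (hHV : ∀ x ∈ S, ∀ v : ℝ, Sum.elim x (fun _ => v) ∈ H ↔ q < v ∧ v < V x)
    (hV : ∀ x ∈ S, q ≤ V x ∧ V x ≤ M) {F F' : (ι → ℝ) → ℝ → ℝ}
    (hder : ∀ x ∈ S, ∀ v ∈ Set.Icc (q : ℝ) (V x), HasDerivAt (F x) (F' x v) v)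
    (h0 : NiceOn S fun x => F x q)
    (h' : NiceOn {w : ι ⊕ Unit → ℝ | w ∘ .inl ∈ S ∧ q < w (.inr ()) ∧ w (.inr ()) < V (w ∘ .inl)}
      fun w => F' (w ∘ .inl) (w (.inr ()))) :
    NiceOn S (fun x => F x (V x)) := by
  have hset : ∀ x ∈ S, {y : Unit → ℝ | Sum.elim x y ∈ H} =
      (MeasurableEquiv.funUnique Unit ℝ) ⁻¹' Set.Ioo (q : ℝ) (V x) := by
    intro x hx
    ext y
    exact hHV x hx (y ())
  have hsub : {w : ι ⊕ Unit → ℝ | w ∘ .inl ∈ S ∧ w ∈ H} ⊆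
      {w | w ∘ .inl ∈ S ∧ q < w (.inr ()) ∧ w (.inr ()) < V (w ∘ .inl)} := by
    rintro w ⟨h1, h2⟩
    refine ⟨h1, (hHV _ h1 _).1 ?_⟩
    convert h2 using 1
    ext (i | i) <;> rfl
  have pres := volume_preserving_funUnique Unit ℝ
  -- The integral of the derivative is taken with weight 1, whose mass on each fibre is the length V
  -- x - q, at most M - q.
  obtain ⟨hint, hnice⟩ := setIntegral hH (h'.mono hsub) .const_one
    (D := ENNReal.ofReal (M - q)) (by finiteness) (fun x hx => by
      rw [hset x hx, setLIntegral_one,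
        pres.measure_preimage measurableSet_Ioo.nullMeasurableSet, Real.volume_Ioo]
      exact ENNReal.ofReal_le_ofReal (by linarith [(hV x hx).2]))
  refine (h0.add hnice).congr fun x hx => ?_
  have hI : IntegrableOn (F' x) (Set.Ioo (q : ℝ) (V x)) := by
    have := hint x hx
    rw [hset x hx] at this
    refine (pres.integrableOn_comp_preimage (MeasurableEquiv.measurableEmbedding _)).1 ?_
    simpa [Function.comp_def] using this
  have hE : ∫ y in {y : Unit → ℝ | Sum.elim x y ∈ H}, (1 : ℝ≥0∞).toReal *
      F' (Sum.elim x y ∘ .inl) (Sum.elim x y (.inr ())) = ∫ v in Set.Ioo (q : ℝ) (V x), F' x v := by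
    rw [hset x hx, ← pres.setIntegral_preimage_emb (MeasurableEquiv.measurableEmbedding _)]
    simp
  rw [hE, ← integral_Ioc_eq_integral_Ioo, ← intervalIntegral.integral_of_le (hV x hx).1,
    intervalIntegral.integral_eq_sub_of_hasDerivAt]
  · ring
  · rw [Set.uIcc_of_le (hV x hx).1]
    exact hder x hx
  · exact (intervalIntegrable_iff_integrableOn_Ioo_of_le (hV x hx).1).2 hI

end NiceOn

/-! ### Algebraic constants -/

/-- A real algebraic number is separated from its left neighbours by a rational polynomial. -/
theorem exists_polynomial_pos_iff_lt {α : ℝ} (hα : IsAlgebraic ℚ α) :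
    ∃ (P : Polynomial ℚ) (r s : ℚ), (r : ℝ) < α ∧ α < s ∧
      ∀ v : ℝ, r < v → v < s → (0 < Polynomial.aeval v P ↔ v < α) := by
  have hirr := minpoly.irreducible hα.isIntegral
  -- Separability makes α a simple root, so up to sign the minimal polynomial is strictly decreasing
  -- near α.
  have hsep : Polynomial.aeval α (minpoly ℚ α).derivative ≠ 0 :=
    hirr.separable.aeval_derivative_ne_zero (minpoly.aeval ℚ α)
  obtain ⟨P, hP0, hP1⟩ : ∃ P : Polynomial ℚ, Polynomial.aeval α P = 0 ∧
      Polynomial.aeval α P.derivative < 0 := by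
    rcases lt_or_gt_of_ne hsep with h | h
    · exact ⟨_, minpoly.aeval ℚ α, h⟩
    · exact ⟨-minpoly ℚ α, by simp, by simpa using h⟩
  have hc : Continuous fun v : ℝ => Polynomial.aeval v P.derivative :=
    P.derivative.continuous_aeval
  obtain ⟨ε, hε, hball⟩ := Metric.eventually_nhds_iff_ball.1
    (hc.continuousAt.eventually_lt continuousAt_const hP1)
  obtain ⟨r, hr1, hr2⟩ := exists_rat_btwn (show α - ε < α by linarith)
  obtain ⟨s, hs1, hs2⟩ := exists_rat_btwn (show α < α + ε by linarith)
  have hanti : StrictAntiOn (fun v : ℝ => Polynomial.aeval v P) (Set.Ioo (r : ℝ) s) := by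
    refine strictAntiOn_of_deriv_neg (convex_Ioo _ _) P.continuous_aeval.continuousOn fun v hv => ?_
    rw [interior_Ioo] at hv
    rw [Polynomial.deriv_aeval]
    refine hball v ?_
    rw [Real.ball_eq_Ioo]
    exact ⟨by linarith [hv.1], by linarith [hv.2]⟩
  refine ⟨P, r, s, hr2, hs1, fun v h1 h2 => ?_⟩
  have := hanti.lt_iff_gt (a := α) (b := v) ⟨hr2, hs1⟩ ⟨h1, h2⟩
  simpa [hP0] using this

theorem IsPolyFun.polynomial_aeval {ι : Type} {f : (ι → ℝ) → ℝ} (hf : IsPolyFun f)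
    (P : Polynomial ℚ) : IsPolyFun (fun x => Polynomial.aeval (f x) P) := by
  obtain ⟨Q, hQ⟩ := hf
  refine ⟨Polynomial.aeval Q P, fun x => ?_⟩
  simp only [hQ, Polynomial.aeval_algHom_apply]

/-- Below the rational endpoint r the inequality is automatic; between r and s the sign of the
isolating polynomial decides it. -/
theorem SemialgQ.lt_algebraic {ι : Type} {f : (ι → ℝ) → ℝ} (hf : IsPolyFun f) {α : ℝ}
    (hα : IsAlgebraic ℚ α) : SemialgQ {x | f x < α} := by
  obtain ⟨P, r, s, hr, hs, h⟩ := exists_polynomial_pos_iff_lt hα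
  have hS : SemialgQ {x | f x ≤ r ∨ (f x < s ∧ 0 < Polynomial.aeval (f x) P)} :=
    (SemialgQ.le hf (.const r)).or
      ((SemialgQ.lt hf (.const s)).and (SemialgQ.lt .zero (hf.polynomial_aeval P)))
  convert hS using 1
  ext x
  simp only [Set.mem_ofPred_eq]
  rcases le_or_gt (f x) r with h1 | h1
  · simp [h1, h1.trans_lt hr]
  · constructor
    · exact fun h2 => .inr ⟨h2.trans hs, (h _ h1 (h2.trans hs)).2 h2⟩
    · rintro (h2 | h2)
      · linarith
      · exact (h _ h1 h2.1).1 h2.2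

/-- The number α is a rational q < α plus the integral of 1 over (q, α), an interval that is
semialgebraic over ℚ. -/
theorem NiceOn.algebraic {ι : Type} [Finite ι] {S : Set (ι → ℝ)} {α : ℝ} (hα : IsAlgebraic ℚ α) :
    NiceOn S (fun _ => α) := by
  obtain ⟨q, -, hq⟩ := exists_rat_btwn (show α - 1 < α by linarith)
  refine newton_leibniz (V := fun _ => α) (F := fun _ v => v) (F' := fun _ _ => 1) (q := q) (M := α)
    (H := {w | (q : ℝ) < w (.inr ()) ∧ w (.inr ()) < α}) ?_ ?_ ?_ ?_ (.const q) .one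
  · exact (SemialgQ.lt (.const q) (.coord _)).and (.lt_algebraic (.coord _) hα)
  · intro x _ v; rfl
  · exact fun _ _ => ⟨hq.le, le_rfl⟩
  · exact fun _ _ v _ => hasDerivAt_id v

/-! ### Complex-valued functions -/

/-- Complex functions with polynomial real and imaginary parts. -/
def IsPolyC {ι : Type} (u : (ι → ℝ) → ℂ) : Prop :=
  IsPolyFun (fun x => (u x).re) ∧ IsPolyFun (fun x => (u x).im)

namespace IsPolyC

variable {ι : Type} {u v : (ι → ℝ) → ℂ}

theorem ofReal {f : (ι → ℝ) → ℝ} (hf : IsPolyFun f) : IsPolyC (fun x => (f x : ℂ)) :=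
  ⟨by simpa using hf, by simpa using IsPolyFun.zero⟩

theorem I : IsPolyC (fun _ : ι → ℝ => Complex.I) :=
  ⟨by simpa using IsPolyFun.zero, by simpa using IsPolyFun.one⟩

theorem one : IsPolyC (fun _ : ι → ℝ => (1 : ℂ)) := by
  simpa using ofReal (ι := ι) .one

theorem add (hu : IsPolyC u) (hv : IsPolyC v) : IsPolyC (fun x => u x + v x) :=
  ⟨by simpa using hu.1.add hv.1, by simpa using hu.2.add hv.2⟩

theorem sub (hu : IsPolyC u) (hv : IsPolyC v) : IsPolyC (fun x => u x - v x) :=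
  ⟨by simpa using hu.1.sub hv.1, by simpa using hu.2.sub hv.2⟩

theorem mul (hu : IsPolyC u) (hv : IsPolyC v) : IsPolyC (fun x => u x * v x) :=
  ⟨by simpa using (hu.1.mul hv.1).sub (hu.2.mul hv.2),
    by simpa using (hu.1.mul hv.2).add (hu.2.mul hv.1)⟩

theorem conj (hu : IsPolyC u) : IsPolyC (fun x => (starRingEnd ℂ) (u x)) :=
  ⟨by simpa using hu.1, by simpa using hu.2.neg⟩

theorem pow (hu : IsPolyC u) (n : ℕ) : IsPolyC (fun x => u x ^ n) := by
  induction n with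
  | zero => simpa using one
  | succ n ih => simpa only [pow_succ] using ih.mul hu

theorem comp (hu : IsPolyC u) {κ : Type} {φ : (κ → ℝ) → ι → ℝ}
    (hφ : ∀ i, IsPolyFun (fun x => φ x i)) : IsPolyC (fun x => u (φ x)) :=
  ⟨hu.1.comp hφ, hu.2.comp hφ⟩

end IsPolyC

/-- Complex functions whose real and imaginary parts are differences of bounded volume functions. -/
def NiceC {ι : Type} (S : Set (ι → ℝ)) (u : (ι → ℝ) → ℂ) : Prop :=
  NiceOn S (fun x => (u x).re) ∧ NiceOn S (fun x => (u x).im)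

namespace NiceC

variable {ι : Type} {S : Set (ι → ℝ)} {u v : (ι → ℝ) → ℂ}

theorem mono (hu : NiceC S u) {T : Set (ι → ℝ)} (h : T ⊆ S) : NiceC T u :=
  ⟨hu.1.mono h, hu.2.mono h⟩

theorem congr (hu : NiceC S u) (h : ∀ x ∈ S, v x = u x) : NiceC S v :=
  ⟨hu.1.congr fun x hx => by rw [h x hx], hu.2.congr fun x hx => by rw [h x hx]⟩

theorem comp (hu : NiceC S u) {κ : Type} {φ : (κ → ℝ) → ι → ℝ} {T : Set (κ → ℝ)}
    (hφ : ∀ i, IsPolyFun (fun x => φ x i)) (hT : ∀ x ∈ T, φ x ∈ S) :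
    NiceC T (fun x => u (φ x)) :=
  ⟨hu.1.comp hφ hT, hu.2.comp hφ hT⟩

theorem conj (hu : NiceC S u) : NiceC S (fun x => (starRingEnd ℂ) (u x)) :=
  ⟨by simpa using hu.1, by simpa using hu.2.neg⟩

variable [Finite ι]

theorem ofReal {f : (ι → ℝ) → ℝ} (hf : NiceOn S f) : NiceC S (fun x => (f x : ℂ)) :=
  ⟨by simpa using hf, by simpa using NiceOn.zero⟩

theorem one : NiceC S (fun _ => (1 : ℂ)) := by
  simpa using ofReal (S := S) .one

theorem I : NiceC S (fun _ => Complex.I) :=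
  ⟨by simpa using NiceOn.zero, by simpa using NiceOn.one⟩

theorem ratCast (q : ℚ) : NiceC S (fun _ => (q : ℂ)) := by
  simpa using ofReal (S := S) (.const q)

theorem add (hu : NiceC S u) (hv : NiceC S v) : NiceC S (fun x => u x + v x) :=
  ⟨by simpa using hu.1.add hv.1, by simpa using hu.2.add hv.2⟩

theorem mul (hu : NiceC S u) (hv : NiceC S v) : NiceC S (fun x => u x * v x) :=
  ⟨by simpa using (hu.1.mul hv.1).sub (hu.2.mul hv.2),
    by simpa using (hu.1.mul hv.2).add (hu.2.mul hv.1)⟩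

theorem pow (hu : NiceC S u) (n : ℕ) : NiceC S (fun x => u x ^ n) := by
  induction n with
  | zero => simpa using one
  | succ n ih => simpa only [pow_succ] using ih.mul hu

/-- `newton_leibniz` for complex valued functions. -/
theorem newton_leibniz {V : (ι → ℝ) → ℝ} {q : ℚ} {M : ℝ} {H : Set (ι ⊕ Unit → ℝ)}
    (hH : SemialgQ H)
    (hHV : ∀ x ∈ S, ∀ v : ℝ, Sum.elim x (fun _ => v) ∈ H ↔ q < v ∧ v < V x)
    (hV : ∀ x ∈ S, q ≤ V x ∧ V x ≤ M) {F F' : (ι → ℝ) → ℝ → ℂ}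
    (hder : ∀ x ∈ S, ∀ v ∈ Set.Icc (q : ℝ) (V x), HasDerivAt (F x) (F' x v) v)
    (h0 : NiceC S fun x => F x q)
    (h' : NiceC {w : ι ⊕ Unit → ℝ | w ∘ .inl ∈ S ∧ q < w (.inr ()) ∧ w (.inr ()) < V (w ∘ .inl)}
      fun w => F' (w ∘ .inl) (w (.inr ()))) :
    NiceC S (fun x => F x (V x)) :=
  ⟨NiceOn.newton_leibniz hH hHV hV (F := fun x v => (F x v).re) (F' := fun x v => (F' x v).re)
      (fun x hx v hv => Complex.reCLM.hasFDerivAt.comp_hasDerivAt v (hder x hx v hv)) h0.1 h'.1,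
    NiceOn.newton_leibniz hH hHV hV (F := fun x v => (F x v).im) (F' := fun x v => (F' x v).im)
      (fun x hx v hv => Complex.imCLM.hasFDerivAt.comp_hasDerivAt v (hder x hx v hv)) h0.2 h'.2⟩

end NiceC

/-! ### Rational powers in the right half-plane -/

theorem Complex.one_add_mul_I_eq_exp_arctan (v : ℝ) :
    (1 + v * Complex.I : ℂ) = (√(1 + v ^ 2) : ℝ) * Complex.exp (Real.arctan v * Complex.I) := by
  have h : √(1 + v ^ 2) ≠ 0 := (Real.sqrt_pos.2 (by positivity)).ne'
  rw [Complex.exp_mul_I, ← Complex.ofReal_cos, ← Complex.ofReal_sin, Real.cos_arctan,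
    Real.sin_arctan]
  apply Complex.ext <;> simp [h] <;> field_simp

theorem Complex.exp_two_mul_arctan_mul_I (v : ℝ) :
    Complex.exp (2 * Real.arctan v * Complex.I) =
      (1 + v * Complex.I) ^ 2 * ((1 + v ^ 2) ^ ((-1 : ℚ) : ℝ) : ℝ) := by
  have h : (0 : ℝ) < 1 + v ^ 2 := by positivity
  rw [one_add_mul_I_eq_exp_arctan, mul_pow, ← Complex.exp_nat_mul, ← Complex.ofReal_pow,
    Real.sq_sqrt h.le]
  rw [show ((-1 : ℚ) : ℝ) = -1 by norm_num, Real.rpow_neg_one,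
    mul_right_comm ((1 + v ^ 2 : ℝ) : ℂ),
    ← Complex.ofReal_mul, mul_inv_cancel₀ h.ne', Complex.ofReal_one, one_mul, Nat.cast_ofNat,
    mul_assoc]

/-- Under the tangent parametrization of the circle, e ^ (2 i arctan v) is a rational function of v
with denominator 1 + v², hence so are its integer powers; inverses are conjugates. -/
theorem NiceC.exp_arctan {ι : Type} [Finite ι] {S : Set (ι → ℝ)} {f : (ι → ℝ) → ℝ}
    (hf : IsPolyFun f) (hb : ∀ x ∈ S, |f x| ≤ 1) (l : ℤ) :
    NiceC S (fun x => Complex.exp (l * (2 * Real.arctan (f x) * Complex.I))) := by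
  have hsq : ∀ x ∈ S, f x ^ 2 ≤ 1 := fun x hx => (sq_le_one_iff_abs_le_one _).2 (hb x hx)
  have h1 : NiceC S (fun x => Complex.exp (2 * Real.arctan (f x) * Complex.I)) := by
    simp only [Complex.exp_two_mul_arctan_mul_I]
    refine ((NiceC.one.add ((NiceC.ofReal (.poly hf 1 hb)).mul .I)).pow 2).mul (.ofReal ?_)
    refine NiceOn.rpow (IsPolyFun.one.add (hf.pow 2)) (δ := 1) (M := 2) one_pos (fun x hx => ?_) _
    exact ⟨by nlinarith [sq_nonneg (f x)], by linarith [hsq x hx]⟩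
  have h2 : NiceC S (fun x => Complex.exp (-(2 * Real.arctan (f x) * Complex.I))) := by
    refine h1.conj.congr fun x _ => ?_
    rw [← Complex.exp_conj]
    simp only [map_mul, Complex.conj_ofReal, Complex.conj_I, map_ofNat, mul_neg]
  obtain ⟨n, rfl | rfl⟩ := l.eq_nat_or_neg
  · simpa [Complex.exp_nat_mul] using h1.pow n
  · refine (h2.pow n).congr fun x _ => ?_
    rw [← Complex.exp_nat_mul]
    simp

/-- Semialgebraic description of the inequality `v < tan (θ / (2 N))`, for `θ` the argument of a
complex number in the right half-plane. -/
theorem lt_tan_arg_div_iff {N : ℕ} (hN : 2 ≤ N) {κ : ℝ} (h1 : Real.tan (Real.pi / (4 * N)) < κ)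
    (h2 : κ < Real.tan (Real.pi / (2 * N))) {u : ℂ} (hu : 0 < u.re) (v : ℝ) :
    (-κ < v ∧ v < κ ∧ ((((1 + v * Complex.I) ^ (2 * N)).re ≤ 0 ∧ v < 0) ∨
      (0 < ((1 + v * Complex.I) ^ (2 * N)).re ∧
        ((1 + v * Complex.I) ^ (2 * N) * (starRingEnd ℂ) u).im < 0))) ↔
    -κ < v ∧ v < Real.tan (u.arg / (2 * N)) := by
  have hN' : (2 : ℝ) ≤ N := by exact_mod_cast hN
  have hpi := Real.pi_pos
  have hθ : |u.arg| < Real.pi / 2 := by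
    rw [Complex.abs_arg_lt_pi_div_two_iff]
    exact .inl hu
  rw [abs_lt] at hθ
  have hd : Real.arctan (Real.tan (u.arg / (2 * N))) = u.arg / (2 * N) := by
    apply Real.arctan_tan
    · rw [lt_div_iff₀ (by positivity)]; nlinarith
    · rw [div_lt_iff₀ (by positivity)]; nlinarith
  have hd4 : Real.arctan (Real.tan (Real.pi / (4 * N))) = Real.pi / (4 * N) := by
    apply Real.arctan_tan
    · have : 0 < Real.pi / (4 * N) := by positivity
      linarith
    · rw [div_lt_iff₀ (by positivity)]; nlinarith
  have hd2 : Real.arctan (Real.tan (Real.pi / (2 * N))) = Real.pi / (2 * N) := by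
    apply Real.arctan_tan
    · have : 0 < Real.pi / (2 * N) := by positivity
      linarith
    · rw [div_lt_iff₀ (by positivity)]; nlinarith
  set φ := Real.arctan v with hφ
  set p := 2 * N * φ with hp
  -- Since arg u < π / 2, the tangent stays below tan (π / (4 N)), hence below κ.
  have hVκ : Real.tan (u.arg / (2 * N)) < κ := by
    refine lt_of_le_of_lt ?_ h1
    rw [← Real.arctan_le_arctan_iff, hd, hd4, div_le_div_iff₀ (by positivity) (by positivity)]
    nlinarith
  have hlt : v < Real.tan (u.arg / (2 * N)) ↔ p < u.arg := by
    rw [← Real.arctan_lt_arctan_iff, hd, lt_div_iff₀ (by positivity), hp, mul_comm]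
  have hv0 : v < 0 ↔ p < 0 := by
    rw [← Real.arctan_lt_arctan_iff, Real.arctan_zero, hp, ← hφ]
    constructor
    · intro h
      exact mul_neg_of_pos_of_neg (by positivity) h
    · intro h
      by_contra h'
      have : 0 ≤ 2 * N * φ := mul_nonneg (by positivity) (not_lt.1 h')
      linarith
  have hpow : (1 + v * Complex.I) ^ (2 * N) =
      ((√(1 + v ^ 2) ^ (2 * N) : ℝ) : ℂ) * Complex.exp (p * Complex.I) := by
    rw [Complex.one_add_mul_I_eq_exp_arctan, mul_pow, ← Complex.exp_nat_mul, Complex.ofReal_pow, hp]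
    congr 2
    push_cast [-Complex.ofReal_arctan]
    ring
  have hρ : 0 < √(1 + v ^ 2) ^ (2 * N) := by positivity
  set ρ := √(1 + v ^ 2) ^ (2 * N)
  have hre : ((1 + v * Complex.I) ^ (2 * N)).re = ρ * Real.cos p := by
    rw [hpow, Complex.re_ofReal_mul, Complex.exp_ofReal_mul_I_re]
  have hn : 0 < ‖u‖ := by
    rw [norm_pos_iff]
    rintro rfl
    simp at hu
  have him : ((1 + v * Complex.I) ^ (2 * N) * (starRingEnd ℂ) u).im =
      ρ * ‖u‖ * Real.sin (p - u.arg) := by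
    have hc : (starRingEnd ℂ) u = ‖u‖ * Complex.exp (-u.arg * Complex.I) := by
      conv_lhs => rw [← Complex.norm_mul_exp_arg_mul_I u]
      rw [map_mul, ← Complex.exp_conj]
      simp
    rw [hc, hpow, mul_mul_mul_comm, ← Complex.exp_add, ← Complex.ofReal_mul, Complex.im_ofReal_mul,
      ← Complex.exp_ofReal_mul_I_im]
    congr 3
    push_cast
    ring
  rw [hre, him, hlt, hv0]
  refine and_congr_right fun hl => ?_
  -- The bound κ < tan (π / (2 N)) confines p = 2 N arctan v, the argument of (1 + v i) ^ (2 N), to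
  -- (-π, π), so no winding ambiguity arises.
  have hup : v < κ → p < Real.pi := fun h => by
    have h3 := Real.arctan_lt_arctan_iff.2 (h.trans h2)
    rw [hd2, lt_div_iff₀ (by positivity)] at h3
    rw [hp]
    linarith
  have hlow : -Real.pi < p := by
    have h3 := Real.arctan_lt_arctan_iff.2 (show -v < Real.tan (Real.pi / (2 * N)) by linarith)
    rw [hd2, Real.arctan_neg, lt_div_iff₀ (by positivity)] at h3
    rw [hp]
    linarith
  have hcos : (ρ * Real.cos p ≤ 0 ↔ Real.cos p ≤ 0) ∧ (0 < ρ * Real.cos p ↔ 0 < Real.cos p) :=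
    ⟨by rw [mul_nonpos_iff_pos_imp_nonpos]; simp [hρ, hρ.le], by simp [hρ]⟩
  have hsin : ρ * ‖u‖ * Real.sin (p - u.arg) < 0 ↔ Real.sin (p - u.arg) < 0 := by
    have : 0 < ρ * ‖u‖ := by positivity
    constructor
    · intro h
      by_contra h'
      have := mul_nonneg this.le (not_lt.1 h')
      linarith
    · exact fun h => mul_neg_of_pos_of_neg this h
  rw [hcos.1, hcos.2, hsin]
  have hltκ : p < u.arg → v < κ := fun h => (hlt.2 h).trans hVκ
  -- If cos p ≤ 0, then |p| ≥ π / 2 > |arg u| and the sign of v decides the comparison; if cos p >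
  -- 0, then |p - arg u| < π and the sign of sin (p - arg u) decides it.
  constructor
  · rintro ⟨hκ, ⟨hc, h0⟩ | ⟨hc, hs⟩⟩
    · by_contra h'
      have := Real.cos_pos_of_mem_Ioo (x := p) ⟨by linarith, by linarith⟩
      linarith
    · have hpu := hup hκ
      have ha : p < Real.pi / 2 := by
        by_contra h'
        have := Real.cos_nonpos_of_pi_div_two_le_of_le (not_lt.1 h') (by linarith)
        linarith
      by_contra h'
      have := Real.sin_nonneg_of_nonneg_of_le_pi (x := p - u.arg) (by linarith) (by linarith)
      linarith
  · intro h
    refine ⟨hltκ h, ?_⟩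
    rcases le_or_gt (Real.cos p) 0 with hc | hc
    · refine .inl ⟨hc, ?_⟩
      by_contra h'
      have := Real.cos_pos_of_mem_Ioo (x := p) ⟨by linarith, by linarith⟩
      linarith
    · refine .inr ⟨hc, ?_⟩
      have ha : -(Real.pi / 2) < p := by
        by_contra h'
        have := Real.cos_nonpos_of_pi_div_two_le_of_le (x := -p) (by linarith) (by linarith)
        rw [Real.cos_neg] at this
        linarith
      exact Real.sin_neg_of_neg_of_neg_pi_lt (by linarith) (by linarith)

/-- Rational powers of polynomial functions with values in the right half-plane. -/
theorem NiceC.cpow {ι : Type} [Finite ι] {S : Set (ι → ℝ)} {u : (ι → ℝ) → ℂ} (hu : IsPolyC u)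
    {δ M : ℝ} (hδ : 0 < δ) (hS : ∀ x ∈ S, δ ≤ (u x).re ∧ ‖u x‖ ≤ M) (e : ℚ) :
    NiceC S (fun x => u x ^ (e : ℂ)) := by
  -- With l = 2 `e.num` below, l · 2 · arg u / (2 N) = e · arg u. Doubling numerator and denominator
  -- ensures N ≥ 2, so that π / (2 N) < π / 2 and a rational κ < 1 fits between the two tangents.
  set N : ℕ := 2 * e.den with hNdef
  have hN : 2 ≤ N := by have := e.den_pos; omega
  have hN' : (2 : ℝ) ≤ N := by exact_mod_cast hN
  have hpi := Real.pi_pos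
  have htan : Real.tan (Real.pi / (4 * N)) < min 1 (Real.tan (Real.pi / (2 * N))) := by
    rw [lt_min_iff]
    have h4 : Real.pi / (4 * N) < Real.pi / 4 := by
      rw [div_lt_div_iff₀ (by positivity) (by positivity)]; nlinarith
    have h42 : Real.pi / (4 * N) < Real.pi / (2 * N) := by
      rw [div_lt_div_iff₀ (by positivity) (by positivity)]; nlinarith
    have h2 : Real.pi / (2 * N) < Real.pi / 2 := by
      rw [div_lt_div_iff₀ (by positivity) (by positivity)]; nlinarith
    have h0 : 0 < Real.pi / (4 * N) := by positivity
    refine ⟨?_, Real.tan_lt_tan_of_lt_of_lt_pi_div_two (by linarith) h2 h42⟩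
    rw [← Real.tan_pi_div_four]
    exact Real.tan_lt_tan_of_lt_of_lt_pi_div_two (by linarith) (by linarith) h4
  obtain ⟨κ, hκ1, hκ2⟩ := exists_rat_btwn htan
  rw [lt_min_iff] at hκ2
  have hre : ∀ x ∈ S, 0 < (u x).re := fun x hx => hδ.trans_le (hS x hx).1
  have hV : ∀ x ∈ S, ((-κ : ℚ) : ℝ) ≤ Real.tan ((u x).arg / (2 * N)) ∧
      Real.tan ((u x).arg / (2 * N)) ≤ κ := by
    intro x hx
    have hθ : |(u x).arg| < Real.pi / 2 := by
      rw [Complex.abs_arg_lt_pi_div_two_iff]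
      exact .inl (hre x hx)
    rw [abs_lt] at hθ
    have h4 : Real.pi / (4 * N) < Real.pi / 2 := by
      rw [div_lt_div_iff₀ (by positivity) (by positivity)]; nlinarith
    have hle : (u x).arg / (2 * N) ≤ Real.pi / (4 * N) := by
      rw [div_le_div_iff₀ (by positivity) (by positivity)]; nlinarith
    have hge : -(Real.pi / (4 * N)) ≤ (u x).arg / (2 * N) := by
      rw [neg_le, ← neg_div, div_le_div_iff₀ (by positivity) (by positivity)]; nlinarith
    have hmono : MonotoneOn Real.tan (Set.Ioo (-(Real.pi / 2)) (Real.pi / 2)) :=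
      Real.strictMonoOn_tan.monotoneOn
    have hpos : 0 < Real.pi / (4 * N) := by positivity
    constructor
    · have := hmono (a := -(Real.pi / (4 * N))) (b := (u x).arg / (2 * N))
        ⟨by linarith, by linarith⟩ ⟨by linarith, by linarith⟩ hge
      rw [Real.tan_neg] at this
      push_cast
      linarith
    · have := hmono (b := Real.pi / (4 * N)) (a := (u x).arg / (2 * N))
        ⟨by linarith, by linarith⟩ ⟨by linarith, by linarith⟩ hle
      linarith
  have hκ0 : 0 < (κ : ℝ) := by
    refine lt_trans ?_ hκ1
    apply Real.tan_pos_of_pos_of_lt_pi_div_two (by positivity)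
    rw [div_lt_div_iff₀ (by positivity) (by positivity)]; nlinarith
  set l : ℤ := 2 * e.num with hl
  have hphase : NiceC S (fun x => Complex.exp (l *
      (2 * Real.arctan (Real.tan ((u x).arg / (2 * N))) * Complex.I))) := by
    have hcoord : IsPolyFun (fun w : ι ⊕ Unit → ℝ => w (.inr ())) := .coord _
    have hA : IsPolyC (fun w : ι ⊕ Unit → ℝ => (1 + (w (.inr ()) : ℂ) * Complex.I) ^ (2 * N)) :=
      (IsPolyC.one.add ((IsPolyC.ofReal hcoord).mul .I)).pow _
    have hB : IsPolyC (fun w : ι ⊕ Unit → ℝ => (1 + (w (.inr ()) : ℂ) * Complex.I) ^ (2 * N) *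
        (starRingEnd ℂ) (u (w ∘ .inl))) := hA.mul (hu.comp fun _ => .coord _).conj
    refine NiceC.newton_leibniz (q := -κ) (M := κ)
      (F := fun _ v => Complex.exp (l * (2 * Real.arctan v * Complex.I)))
      (F' := fun _ v => Complex.exp (l * (2 * Real.arctan v * Complex.I)) *
        (((2 * l : ℚ) : ℂ) * ((((1 + v ^ 2) ^ ((-1 : ℚ) : ℝ) : ℝ) : ℂ) * Complex.I)))
      ((SemialgQ.lt (IsPolyFun.const (-κ)) hcoord).and ((SemialgQ.lt hcoord (.const κ)).and
        (((SemialgQ.le hA.1 .zero).and (.lt hcoord .zero)).or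
          ((SemialgQ.lt .zero hA.1).and (.lt hB.2 .zero)))))
      (fun x hx v => ?_) hV (fun x _ v _ => ?_) ?_ ?_
    · have := lt_tan_arg_div_iff hN hκ1 hκ2.2 (hre x hx) v
      simpa using this
    · have h1 : HasDerivAt (fun v : ℝ => (Real.arctan v : ℂ)) ((1 / (1 + v ^ 2) : ℝ) : ℂ) v :=
        (Real.hasDerivAt_arctan v).ofReal_comp
      have h2 := (((h1.const_mul 2).mul_const Complex.I).const_mul (l : ℂ)).cexp
      refine h2.congr_deriv ?_
      rw [show ((-1 : ℚ) : ℝ) = -1 by norm_num, Real.rpow_neg_one, one_div]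
      push_cast [-Complex.ofReal_arctan]
      ring
    · refine NiceC.exp_arctan (.const (-κ)) (fun x _ => ?_) l
      rw [abs_le]
      push_cast
      constructor <;> linarith
    · have hb : ∀ w ∈ {w : ι ⊕ Unit → ℝ | w ∘ .inl ∈ S ∧ ((-κ : ℚ) : ℝ) < w (.inr ()) ∧
          w (.inr ()) < Real.tan ((u (w ∘ .inl)).arg / (2 * N))}, |w (.inr ())| ≤ 1 := by
        rintro w ⟨h1, h2, h3⟩
        have := (hV _ h1).2
        push_cast at h2
        rw [abs_le]
        constructor <;> linarith
      refine (NiceC.exp_arctan hcoord hb l).mul ((NiceC.ratCast _).mul ((NiceC.ofReal ?_).mul .I))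
      refine NiceOn.rpow (IsPolyFun.one.add (hcoord.pow 2)) (δ := 1) (M := 2) one_pos
        (fun w hw => ⟨by nlinarith [sq_nonneg (w (.inr ()))], ?_⟩) _
      linarith [(sq_le_one_iff_abs_le_one _).2 (hb w hw)]
  -- The modulus is ‖u‖ ^ e = (re² + im²) ^ (e / 2), a rational power of a real polynomial function.
  have hmod : NiceC S (fun x =>
      (((u x).re * (u x).re + (u x).im * (u x).im) ^ ((e / 2 : ℚ) : ℝ) : ℝ)) := by
    refine NiceC.ofReal (.rpow ((hu.1.mul hu.1).add (hu.2.mul hu.2)) (δ := δ ^ 2) (M := M ^ 2)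
      (by positivity) (fun x hx => ⟨?_, ?_⟩) _)
    · nlinarith [(hS x hx).1, sq_nonneg (u x).im]
    · rw [← Complex.normSq_apply, Complex.normSq_eq_norm_sq]
      exact pow_le_pow_left₀ (norm_nonneg _) (hS x hx).2 2
  refine (hmod.mul hphase).congr fun x hx => ?_
  have hux : u x ≠ 0 := by
    intro h
    have := hre x hx
    simp [h] at this
  have hθ : |(u x).arg| < Real.pi / 2 := by
    rw [Complex.abs_arg_lt_pi_div_two_iff]
    exact .inl (hre x hx)
  rw [abs_lt] at hθ
  have hd : Real.arctan (Real.tan ((u x).arg / (2 * N))) = (u x).arg / (2 * N) := by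
    apply Real.arctan_tan
    · rw [lt_div_iff₀ (by positivity)]; nlinarith
    · rw [div_lt_iff₀ (by positivity)]; nlinarith
  have hn : 0 < ‖u x‖ := norm_pos_iff.2 hux
  rw [hd, ← Complex.normSq_apply, Complex.normSq_eq_norm_sq, Complex.cpow_def_of_ne_zero hux,
    ← Real.rpow_natCast, ← Real.rpow_mul hn.le]
  have h1 : ((‖u x‖ ^ (((2 : ℕ) : ℝ) * ((e / 2 : ℚ) : ℝ)) : ℝ) : ℂ) =
      Complex.exp (Real.log ‖u x‖ * e) := by
    rw [Real.rpow_def_of_pos hn]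
    push_cast
    congr 1
    ring
  rw [h1, ← Complex.exp_add]
  congr 1
  rw [Complex.log]
  have he : (e : ℂ) = e.num / e.den := by
    exact_mod_cast congrArg (fun q : ℚ => (q : ℂ)) (Rat.num_div_den e).symm
  have hden : (e.den : ℂ) ≠ 0 := by exact_mod_cast e.den_ne_zero
  rw [he, hl, hNdef]
  push_cast
  field_simp

/-! ### Powers of 1 - z T for algebraic z -/

/-- The real part 1 - s T is at least 1 for s ≤ 0 and at least 1 - x₀ otherwise. This keeps the base
in the right half-plane along the whole path of the real coordinate from -1 to x₀. -/
theorem Complex.one_sub_mul_bounds {x₀ s η T : ℝ} (hx : x₀ < 1) (hs : -1 ≤ s) (hs' : s ≤ x₀)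
    (hη : |η| ≤ 1) (hT : 0 < T) (hT' : T ≤ 1) :
    min 1 (1 - x₀) ≤ (1 - (s + η * Complex.I) * T : ℂ).re ∧
      ‖(1 - (s + η * Complex.I) * T : ℂ)‖ ≤ 3 := by
  constructor
  · have : (1 - (s + η * Complex.I) * T : ℂ).re = 1 - s * T := by simp
    rw [this]
    rcases le_total s 0 with h | h
    · exact (min_le_left _ _).trans (by nlinarith)
    · exact (min_le_right _ _).trans (by nlinarith)
  · have h1 : ‖(s : ℂ) + η * Complex.I‖ ≤ 2 := by
      refine (norm_add_le _ _).trans ?_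
      have : |s| ≤ 1 := abs_le.2 ⟨by linarith, by linarith⟩
      simp only [Complex.norm_real, norm_mul, Complex.norm_I, mul_one, Real.norm_eq_abs]
      linarith
    refine (norm_sub_le _ _).trans ?_
    rw [norm_mul, norm_one, Complex.norm_real, Real.norm_of_nonneg hT.le]
    nlinarith [norm_nonneg ((s : ℂ) + η * Complex.I)]

/-- The direction a is kept general because the real and the imaginary coordinate of z are moved in
turn, with a = 1 and a = i. -/
theorem Complex.hasDerivAt_one_sub_cpow {a b c : ℂ} (e : ℚ) (v : ℝ)
    (h : 0 < (1 - (b + v * a) * c).re) :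
    HasDerivAt (fun v : ℝ => (1 - (b + v * a) * c) ^ (e : ℂ))
      ((e : ℂ) * (-(a * c)) * (1 - (b + v * a) * c) ^ ((e - 1 : ℚ) : ℂ)) v := by
  have h1 : HasDerivAt (fun v : ℂ => 1 - (b + v * a) * c) (-(a * c)) (v : ℂ) := by
    simpa using (((hasDerivAt_id (v : ℂ)).mul_const a).const_add b).mul_const c |>.const_sub 1
  refine ((h1.cpow_const (c := (e : ℂ)) (.inl h)).comp_ofReal).congr_deriv ?_
  push_cast
  ring

/-- Algebraic specialization of the real part of `z` in `(1 - z T) ^ e`. -/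
theorem NiceC.one_sub_cpow_re {x₀ : ℝ} (hx : IsAlgebraic ℚ x₀) (h1 : x₀ < 1) (h2 : -1 < x₀)
    (e : ℚ) : NiceC {w : Unit ⊕ Unit → ℝ | (0 < w (.inl ()) ∧ w (.inl ()) ≤ 1) ∧
        |w (.inr ())| ≤ 1}
      (fun w => (1 - (x₀ + w (.inr ()) * Complex.I) * w (.inl ())) ^ (e : ℂ)) := by
  have hq : ((-1 : ℚ) : ℝ) = -1 := by norm_num
  have hδ : 0 < min 1 (1 - x₀) := lt_min one_pos (by linarith)
  have hH : SemialgQ {w : (Unit ⊕ Unit) ⊕ Unit → ℝ |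
      ((-1 : ℚ) : ℝ) < w (.inr ()) ∧ w (.inr ()) < x₀} :=
    (SemialgQ.lt (.const (-1)) (.coord _)).and (.lt_algebraic (.coord _) hx)
  -- The real coordinate becomes a variable s running from -1 to x₀. At s = -1 and inside the
  -- integral the base is a polynomial over ℚ in the remaining variables, so `NiceC.cpow` applies.
  refine NiceC.newton_leibniz (q := -1) (M := x₀) (V := fun _ => x₀)
    (F := fun w s => (1 - (s + w (.inr ()) * Complex.I) * w (.inl ())) ^ (e : ℂ))
    (F' := fun w s => (e : ℂ) * ((-w (.inl ()) : ℝ) *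
      (1 - (s + w (.inr ()) * Complex.I) * w (.inl ())) ^ ((e - 1 : ℚ) : ℂ)))
    hH (fun _ _ _ => Iff.rfl) (fun _ _ => ⟨by rw [hq]; exact h2.le, le_rfl⟩) ?_ ?_ ?_
  · rintro w ⟨⟨hT, hT'⟩, hη⟩ s ⟨hs, hs'⟩
    rw [hq] at hs
    have := hδ.trans_le (Complex.one_sub_mul_bounds h1 hs hs' hη hT hT').1
    have h3 := Complex.hasDerivAt_one_sub_cpow (a := 1) (b := w (.inr ()) * Complex.I)
      (c := w (.inl ())) e s (by simpa [add_comm] using this)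
    refine (h3.congr_deriv ?_).congr_of_eventuallyEq (.of_forall fun t => ?_)
    · push_cast
      ring_nf
    · simp [add_comm]
  · refine NiceC.cpow (δ := min 1 (1 - x₀)) (M := 3)
      (IsPolyC.one.sub (((IsPolyC.ofReal (.const (-1))).add
      ((IsPolyC.ofReal (.coord _)).mul .I)).mul (.ofReal (.coord _)))) hδ ?_ e
    rintro w ⟨⟨hT, hT'⟩, hη⟩
    exact Complex.one_sub_mul_bounds h1 hq.ge (by rw [hq]; exact h2.le) hη hT hT'
  · refine (NiceC.ratCast e).mul (.mul (.ofReal (.poly (IsPolyFun.coord _).neg 1 ?_)) ?_)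
    · rintro w ⟨⟨⟨hT, hT'⟩, hη⟩, hs, hs'⟩
      have hT2 : 0 < w (.inl (.inl ())) := hT
      have hT3 : w (.inl (.inl ())) ≤ 1 := hT'
      rw [abs_neg, Function.comp_apply, abs_le]
      constructor <;> linarith
    · refine NiceC.cpow (δ := min 1 (1 - x₀)) (M := 3)
        (IsPolyC.one.sub (((IsPolyC.ofReal (.coord _)).add
        ((IsPolyC.ofReal (.coord _)).mul .I)).mul (.ofReal (.coord _)))) hδ ?_ _
      rintro w ⟨⟨⟨hT, hT'⟩, hη⟩, hs, hs'⟩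
      rw [hq] at hs
      exact Complex.one_sub_mul_bounds h1 hs.le hs'.le hη hT hT'

/-- For algebraic `z` in the unit disc, the powers of `1 - z T` are differences of bounded volume
functions of `T`. -/
theorem NiceC.one_sub_cpow {z : ℂ} (hre : IsAlgebraic ℚ z.re) (him : IsAlgebraic ℚ z.im)
    (hz : ‖z‖ < 1) (e : ℚ) :
    NiceC {x : Unit → ℝ | 0 < x () ∧ x () ≤ 1} (fun x => (1 - z * x ()) ^ (e : ℂ)) := by
  have hq : ((-1 : ℚ) : ℝ) = -1 := by norm_num
  obtain ⟨h2, h1⟩ := abs_lt.1 ((Complex.abs_re_le_norm z).trans_lt hz)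
  obtain ⟨h4, h3⟩ := abs_lt.1 ((Complex.abs_im_le_norm z).trans_lt hz)
  have hδ : 0 < min 1 (1 - z.re) := lt_min one_pos (by linarith)
  have hH : SemialgQ {w : Unit ⊕ Unit → ℝ |
      ((-1 : ℚ) : ℝ) < w (.inr ()) ∧ w (.inr ()) < z.im} :=
    (SemialgQ.lt (.const (-1)) (.coord _)).and (.lt_algebraic (.coord _) him)
  have key : NiceC {x : Unit → ℝ | 0 < x () ∧ x () ≤ 1}
      (fun x => (1 - (z.re + z.im * Complex.I) * x ()) ^ (e : ℂ)) := by
    -- The same specialization for the imaginary coordinate; the starting value and the derivative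
    -- are covered by `NiceC.one_sub_cpow_re` with exponents e and e - 1.
    refine NiceC.newton_leibniz (q := -1) (M := z.im) (V := fun _ => z.im)
      (F := fun x η => (1 - (z.re + η * Complex.I) * x ()) ^ (e : ℂ))
      (F' := fun x η => (e : ℂ) * ((-x () : ℝ) * (Complex.I *
        (1 - (z.re + η * Complex.I) * x ()) ^ ((e - 1 : ℚ) : ℂ))))
      hH (fun _ _ _ => Iff.rfl) (fun _ _ => ⟨by rw [hq]; exact h4.le, le_rfl⟩) ?_ ?_ ?_
    · rintro x ⟨hT, hT'⟩ η ⟨hη, hη'⟩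
      rw [hq] at hη
      have := hδ.trans_le (Complex.one_sub_mul_bounds h1 h2.le le_rfl
        (abs_le.2 ⟨hη, hη'.trans h3.le⟩) hT hT').1
      refine (Complex.hasDerivAt_one_sub_cpow e η this).congr_deriv ?_
      push_cast
      ring
    · refine (NiceC.one_sub_cpow_re hre h1 h2 e).comp
        (φ := fun x => Sum.elim x fun _ => ((-1 : ℚ) : ℝ)) (fun i => ?_) ?_
      · cases i
        · exact .coord _
        · exact .const (-1)
      · rintro x ⟨hT, hT'⟩
        exact ⟨⟨hT, hT'⟩, by simp⟩
    · have hsub : {w : Unit ⊕ Unit → ℝ | w ∘ .inl ∈ {x : Unit → ℝ | 0 < x () ∧ x () ≤ 1} ∧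
          ((-1 : ℚ) : ℝ) < w (.inr ()) ∧ w (.inr ()) < z.im} ⊆
          {w | (0 < w (.inl ()) ∧ w (.inl ()) ≤ 1) ∧ |w (.inr ())| ≤ 1} := by
        rintro w ⟨hT, hη, hη'⟩
        rw [hq] at hη
        exact ⟨hT, abs_le.2 ⟨hη.le, hη'.le.trans h3.le⟩⟩
      refine (NiceC.ratCast e).mul (.mul (.ofReal (.poly (IsPolyFun.coord _).neg 1 ?_)) (.mul .I
        ((NiceC.one_sub_cpow_re hre h1 h2 (e - 1)).mono hsub)))
      intro w hw
      obtain ⟨⟨hT, hT'⟩, -⟩ := hsub hw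
      rw [abs_neg, Function.comp_apply, abs_le]
      constructor <;> linarith
  simpa using key

/-! ### Volume differences and periods -/

/-- Real numbers that are differences of finite volumes of semialgebraic sets. -/
def IsVolumeDiff (r : ℝ) : Prop :=
  NiceOn (Set.univ : Set (Empty → ℝ)) fun _ => r

/-- Complex numbers whose real and imaginary parts are differences of volumes. -/
def IsVolumeDiffC (w : ℂ) : Prop :=
  NiceC (Set.univ : Set (Empty → ℝ)) fun _ => w

namespace IsVolumeDiffC

theorem add {v w : ℂ} (hv : IsVolumeDiffC v) (hw : IsVolumeDiffC w) : IsVolumeDiffC (v + w) :=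
  NiceC.add hv hw

theorem mul {v w : ℂ} (hv : IsVolumeDiffC v) (hw : IsVolumeDiffC w) : IsVolumeDiffC (v * w) :=
  NiceC.mul hv hw

theorem pow {v : ℂ} (hv : IsVolumeDiffC v) (n : ℕ) : IsVolumeDiffC (v ^ n) :=
  NiceC.pow hv n

theorem ofReal {r : ℝ} (hr : IsVolumeDiff r) : IsVolumeDiffC (r : ℂ) :=
  NiceC.ofReal hr

theorem ratCast (q : ℚ) : IsVolumeDiffC (q : ℂ) :=
  NiceC.ratCast q

theorem sum {κ : Type} (s : Finset κ) {F : κ → ℂ} (h : ∀ k ∈ s, IsVolumeDiffC (F k)) :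
    IsVolumeDiffC (∑ k ∈ s, F k) := by
  classical
  induction s using Finset.induction_on with
  | empty => simpa using ratCast 0
  | insert a s ha ih =>
    rw [Finset.sum_insert ha]
    exact (h a (by simp)).add (ih fun k hk => h k (by simp [hk]))

theorem prod {κ : Type} (s : Finset κ) {F : κ → ℂ} (h : ∀ k ∈ s, IsVolumeDiffC (F k)) :
    IsVolumeDiffC (∏ k ∈ s, F k) := by
  classical
  induction s using Finset.induction_on with
  | empty => simpa using ratCast 1
  | insert a s ha ih =>
    rw [Finset.prod_insert ha]
    exact (h a (by simp)).mul (ih fun k hk => h k (by simp [hk]))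

/-- The real and imaginary parts of a complex algebraic number are algebraic. -/
theorem _root_.Complex.isAlgebraic_re_im {z : ℂ} (hz : IsAlgebraic ℚ z) :
    IsAlgebraic ℚ z.re ∧ IsAlgebraic ℚ z.im := by
  have hc : IsAlgebraic ℚ ((starRingEnd ℂ) z) := by
    simpa using hz.algHom (Complex.conjAe.toAlgHom.restrictScalars ℚ)
  have h2 : IsAlgebraic ℚ (2 : ℂ) := by
    simpa using isAlgebraic_algebraMap (R := ℚ) (A := ℂ) (2 : ℚ)
  have hI : IsAlgebraic ℚ Complex.I := Complex.isIntegral_rat_I.isAlgebraic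
  have hinj : Function.Injective (algebraMap ℝ ℂ) := (algebraMap ℝ ℂ).injective
  constructor
  · rw [← isAlgebraic_algebraMap_iff (A := ℂ) hinj]
    have : (algebraMap ℝ ℂ) z.re = (z + (starRingEnd ℂ) z) * 2⁻¹ := by
      rw [Complex.add_conj]
      simp
      field_simp
    rw [this]
    exact (hz.add hc).mul h2.inv
  · rw [← isAlgebraic_algebraMap_iff (A := ℂ) hinj]
    have : (algebraMap ℝ ℂ) z.im = (z - (starRingEnd ℂ) z) * (2 * Complex.I)⁻¹ := by
      rw [Complex.sub_conj]
      simp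
      field_simp
      simp
    rw [this]
    exact (hz.sub hc).mul (h2.mul hI).inv

theorem algebraic {z : ℂ} (hz : IsAlgebraic ℚ z) : IsVolumeDiffC z :=
  ⟨.algebraic (Complex.isAlgebraic_re_im hz).1, .algebraic (Complex.isAlgebraic_re_im hz).2⟩

end IsVolumeDiffC

theorem NiceOn.isVolumeDiff_setIntegral {κ : Type} [Fintype κ] {S : Set (κ → ℝ)} (hS : SemialgQ S)
    {f : (κ → ℝ) → ℝ} (hf : NiceOn S f) {g : (κ → ℝ) → ℝ≥0∞} (hg : IsVolumeFun g)
    (hgS : ∫⁻ y in S, g y ≠ ∞) :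
    IntegrableOn (fun y => (g y).toReal * f y) S ∧
      IsVolumeDiff (∫ y in S, (g y).toReal * f y) := by
  have := NiceOn.setIntegral (ι := Empty) (S := Set.univ) (H := {w | w ∘ .inr ∈ S})
    (F := fun w => f (w ∘ .inr)) (G := fun w => g (w ∘ .inr))
    (hS.preimage fun _ => .coord _) (hf.comp (fun _ => .coord _) fun w hw => hw.2)
    (hg.comp fun _ => .coord _) hgS (fun x _ => le_rfl)
  exact ⟨this.1 Empty.elim trivial, this.2⟩

theorem NiceC.isVolumeDiffC_setIntegral {κ : Type} [Fintype κ] {S : Set (κ → ℝ)} (hS : SemialgQ S)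
    {f : (κ → ℝ) → ℂ} (hf : NiceC S f) {g : (κ → ℝ) → ℝ≥0∞} (hg : IsVolumeFun g)
    (hgS : ∫⁻ y in S, g y ≠ ∞) :
    IsVolumeDiffC (∫ y in S, ((g y).toReal : ℂ) * f y) := by
  obtain ⟨i1, n1⟩ := NiceOn.isVolumeDiff_setIntegral hS hf.1 hg hgS
  obtain ⟨i2, n2⟩ := NiceOn.isVolumeDiff_setIntegral hS hf.2 hg hgS
  have hint : IntegrableOn (fun y => ((g y).toReal : ℂ) * f y) S := by
    have := i1.ofReal (𝕜 := ℂ) |>.add (i2.ofReal (𝕜 := ℂ) |>.mul_const Complex.I)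
    refine this.congr (.of_forall fun y => ?_)
    apply Complex.ext <;> simp
  constructor
  · have h := integral_re (𝕜 := ℂ) hint
    simp only [RCLike.re_to_complex, Complex.re_ofReal_mul] at h
    rw [h] at n1
    exact n1
  · have h := integral_im (𝕜 := ℂ) hint
    simp only [RCLike.im_to_complex, Complex.im_ofReal_mul] at h
    rw [h] at n2
    exact n2

theorem SemialgQ.of_reindex {κ κ' : Type} (e : κ ≃ κ') {s : Set (κ → ℝ)} (hs : SemialgQ s) :
    SemialgQ {x : κ' → ℝ | x ∘ e ∈ s} :=
  hs.preimage fun _ => .coord _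

/-- Integrals of polynomials over semialgebraic sets, with an arbitrary finite index type. -/
theorem isRealPeriod_setIntegral {κ : Type} [Fintype κ] {D : Set (κ → ℝ)} (hD : SemialgQ D)
    (P : MvPolynomial κ ℚ) (hP : IntegrableOn (fun x : κ → ℝ => MvPolynomial.aeval x P) D) :
    IsRealPeriod (∫ x in D, MvPolynomial.aeval x P) := by
  have e := Fintype.equivFin κ
  have pres := volume_measurePreserving_piCongrLeft (fun _ : κ => ℝ) e.symm
  have hset : (MeasurableEquiv.piCongrLeft (fun _ : κ => ℝ) e.symm) ⁻¹' D =
      {x : Fin (Fintype.card κ) → ℝ | x ∘ e ∈ D} := by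
    ext x
    have : MeasurableEquiv.piCongrLeft (fun _ : κ => ℝ) e.symm x = x ∘ e := by
      funext k
      have := MeasurableEquiv.piCongrLeft_apply_apply (β := fun _ : κ => ℝ) e.symm x (e k)
      simpa using this
    simp [this]
  have hfun : ∀ x : Fin (Fintype.card κ) → ℝ,
      MvPolynomial.aeval (MeasurableEquiv.piCongrLeft (fun _ : κ => ℝ) e.symm x) P =
      MvPolynomial.aeval x (MvPolynomial.rename e P) /
        MvPolynomial.aeval x (1 : MvPolynomial _ ℚ) := by
    intro x
    have : MeasurableEquiv.piCongrLeft (fun _ : κ => ℝ) e.symm x = x ∘ e := by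
      funext k
      have := MeasurableEquiv.piCongrLeft_apply_apply (β := fun _ : κ => ℝ) e.symm x (e k)
      simpa using this
    simp [this, MvPolynomial.aeval_rename]
  refine ⟨Fintype.card κ, {x | x ∘ e ∈ D}, MvPolynomial.rename e P, 1,
    (hD.of_reindex e).isRatSemialgebraic, one_ne_zero, ?_, ?_⟩
  · have := (pres.integrableOn_comp_preimage (MeasurableEquiv.measurableEmbedding _)).2 hP
    rw [hset] at this
    simpa only [Function.comp_def, hfun] using this
  · rw [← pres.setIntegral_preimage_emb (MeasurableEquiv.measurableEmbedding _), hset]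
    simp only [hfun]

/-- The integrand 2 s has integral 1 over (0, 1) and -1 over (-1, 0), so a cylinder over A
contributes the volume of A with either sign. -/
theorem integral_cylinder {κ : Type} [Fintype κ] {A : Set (κ → ℝ)} (hA : volume A ≠ ∞)
    {a b : ℝ} (hab : a ≤ b) :
    IntegrableOn (fun w : κ ⊕ Unit → ℝ => 2 * w (.inr ()))
        {w | w ∘ .inl ∈ A ∧ a < w (.inr ()) ∧ w (.inr ()) < b} ∧
      ∫ w in {w : κ ⊕ Unit → ℝ | w ∘ .inl ∈ A ∧ a < w (.inr ()) ∧ w (.inr ()) < b},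
        2 * w (.inr ()) = (volume A).toReal * (b ^ 2 - a ^ 2) := by
  have pres := volume_measurePreserving_sumPiEquivProdPi (fun _ : κ ⊕ Unit => ℝ)
  have presU := volume_preserving_funUnique Unit ℝ
  have hset : {w : κ ⊕ Unit → ℝ | w ∘ .inl ∈ A ∧ a < w (.inr ()) ∧ w (.inr ()) < b} =
      (MeasurableEquiv.sumPiEquivProdPi (fun _ : κ ⊕ Unit => ℝ)) ⁻¹'
      (A ×ˢ ((MeasurableEquiv.funUnique Unit ℝ) ⁻¹' Set.Ioo a b)) := rfl
  have hI : IntegrableOn (fun s : ℝ => 2 * s) (Set.Ioo a b) :=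
    (Continuous.integrableOn_Icc (by fun_prop)).mono_set Set.Ioo_subset_Icc_self
  have hU : IntegrableOn (fun u : Unit → ℝ => 2 * u ())
      ((MeasurableEquiv.funUnique Unit ℝ) ⁻¹' Set.Ioo a b) :=
    (presU.integrableOn_comp_preimage (MeasurableEquiv.measurableEmbedding _)).2 hI
  have h1 : IntegrableOn (fun _ : κ → ℝ => (1 : ℝ)) A := integrableOn_const hA
  have hprod : IntegrableOn (fun z : (κ → ℝ) × (Unit → ℝ) => 1 * (2 * z.2 ()))
      (A ×ˢ ((MeasurableEquiv.funUnique Unit ℝ) ⁻¹' Set.Ioo a b)) := by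
    rw [IntegrableOn, Measure.volume_eq_prod, ← Measure.prod_restrict]
    exact h1.mul_prod hU
  constructor
  · rw [hset]
    have := (pres.integrableOn_comp_preimage (MeasurableEquiv.measurableEmbedding _)).2 hprod
    simpa [Function.comp_def] using! this
  · rw [hset]
    have h2 := pres.setIntegral_preimage_emb (MeasurableEquiv.measurableEmbedding _)
      (fun z : (κ → ℝ) × (Unit → ℝ) => 1 * (2 * z.2 ()))
      (A ×ˢ ((MeasurableEquiv.funUnique Unit ℝ) ⁻¹' Set.Ioo a b))
    rw [Measure.volume_eq_prod,
      setIntegral_prod_mul (fun _ => (1 : ℝ)) (fun u : Unit → ℝ => 2 * u ())] at h2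
    have h3 : ∫ u in (MeasurableEquiv.funUnique Unit ℝ) ⁻¹' Set.Ioo a b, 2 * u () =
        b ^ 2 - a ^ 2 := by
      have h4 := presU.setIntegral_preimage_emb (MeasurableEquiv.measurableEmbedding _)
        (fun s : ℝ => 2 * s) (Set.Ioo a b)
      rw [← integral_Ioc_eq_integral_Ioo, ← intervalIntegral.integral_of_le hab,
        intervalIntegral.integral_const_mul, integral_id] at h4
      refine Eq.trans ?_ (h4.trans (by ring))
      rfl
    rw [h3] at h2
    simp only [one_mul, setIntegral_const, smul_eq_mul, mul_one] at h2
    exact h2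

/-- Cylinders over the two sets, above the disjoint intervals (0, 1) and (-1, 0), carry the single
polynomial integrand 2 s, so the difference of volumes becomes one integral. -/
theorem IsVolumeDiff.isRealPeriod {r : ℝ} (hr : IsVolumeDiff r) : IsRealPeriod r := by
  obtain ⟨f₁, f₂, C, h1, h2, hC, hf⟩ := hr
  obtain ⟨κ, _, A, B, hA, hB, hfA, hfB⟩ := h1.exists_common h2
  obtain ⟨b1, b2, heq⟩ := hf Empty.elim trivial
  set A' : Set (κ → ℝ) := {y | Sum.elim Empty.elim y ∈ A}
  set B' : Set (κ → ℝ) := {y | Sum.elim Empty.elim y ∈ B}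
  have hA' : SemialgQ A' := hA.preimage fun i => by
    rcases i with i | i
    · exact i.elim
    · exact .coord _
  have hB' : SemialgQ B' := hB.preimage fun i => by
    rcases i with i | i
    · exact i.elim
    · exact .coord _
  rw [hfA] at b1
  rw [hfB] at b2
  rw [hfA, hfB] at heq
  have finA : volume A' ≠ ∞ := ne_top_of_le_ne_top hC b1
  have finB : volume B' ≠ ∞ := ne_top_of_le_ne_top hC b2
  obtain ⟨i1, e1⟩ := integral_cylinder finA zero_le_one
  obtain ⟨i2, e2⟩ := integral_cylinder finB (show (-1 : ℝ) ≤ 0 by norm_num)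
  set D₁ := {w : κ ⊕ Unit → ℝ | w ∘ .inl ∈ A' ∧ 0 < w (.inr ()) ∧ w (.inr ()) < 1}
  set D₂ := {w : κ ⊕ Unit → ℝ | w ∘ .inl ∈ B' ∧ -1 < w (.inr ()) ∧ w (.inr ()) < 0}
  have hD₁ : SemialgQ D₁ := (hA'.preimage fun _ => .coord _).and
    ((SemialgQ.lt .zero (.coord _)).and (SemialgQ.lt (.coord _) .one))
  have hD₂ : SemialgQ D₂ := (hB'.preimage fun _ => .coord _).and
    ((SemialgQ.lt (by simpa using IsPolyFun.const (-1)) (.coord _)).and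
      (SemialgQ.lt (.coord _) .zero))
  have hdisj : Disjoint D₁ D₂ := by
    rw [Set.disjoint_left]
    rintro w ⟨_, h1, _⟩ ⟨_, _, h2⟩
    linarith
  have hP : ∀ w : κ ⊕ Unit → ℝ, MvPolynomial.aeval w (2 * MvPolynomial.X (.inr ()) :
      MvPolynomial (κ ⊕ Unit) ℚ) = 2 * w (.inr ()) := fun w => by simp
  have := isRealPeriod_setIntegral (hD₁.union hD₂) (2 * MvPolynomial.X (.inr ()))
    (by simpa only [hP] using i1.union i2)
  simp only [hP] at this
  rw [setIntegral_union hdisj hD₂.measurableSet i1 i2, e1, e2] at this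
  convert this using 1
  refine Eq.trans heq ?_
  ring

theorem IsVolumeDiffC.mem_kzPeriods {w : ℂ} (hw : IsVolumeDiffC w) : w ∈ kzPeriods :=
  ⟨IsVolumeDiff.isRealPeriod hw.1, IsVolumeDiff.isRealPeriod hw.2⟩

/-- π is the integral over the line of (1 + y²)⁻¹, used here as the weight, with constant integrand
1. -/
theorem isVolumeDiff_pi : IsVolumeDiff Real.pi := by
  have hpoly : IsPolyFun (fun y : Unit → ℝ => 1 + y () ^ 2) :=
    IsPolyFun.one.add ((IsPolyFun.coord _).pow 2)
  have hpos : ∀ y : Unit → ℝ, 0 < 1 + y () ^ 2 := fun y => by positivity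
  have hg := IsVolumeFun.ofReal_rpow hpoly (-1)
  have hval : ∀ y : Unit → ℝ, (if 0 < 1 + y () ^ 2 then (1 + y () ^ 2) ^ (((-1 : ℚ)) : ℝ) else 0) =
      (1 + y () ^ 2)⁻¹ := fun y => by
    rw [if_pos (hpos y), show ((-1 : ℚ) : ℝ) = -1 by norm_num, Real.rpow_neg_one]
  simp only [hval] at hg
  have presU := volume_preserving_funUnique Unit ℝ
  have hint : Integrable (fun y : Unit → ℝ => (1 + y () ^ 2)⁻¹) :=
    (presU.integrable_comp_emb (MeasurableEquiv.measurableEmbedding _)).2 integrable_inv_one_add_sq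
  have hpi : ∫ y : Unit → ℝ, (1 + y () ^ 2)⁻¹ = Real.pi := by
    have := presU.integral_comp' (g := fun s : ℝ => (1 + s ^ 2)⁻¹)
    rw [integral_univ_inv_one_add_sq] at this
    exact this
  have := (NiceOn.isVolumeDiff_setIntegral SemialgQ.univ (NiceOn.one) hg (by
    rw [Measure.restrict_univ]
    exact hint.lintegral_lt_top.ne)).2
  have hto : ∀ y : Unit → ℝ, (ENNReal.ofReal (1 + y () ^ 2)⁻¹).toReal * 1 = (1 + y () ^ 2)⁻¹ :=
    fun y => by rw [ENNReal.toReal_ofReal (inv_nonneg.2 (hpos y).le), mul_one]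
  simpa only [hto, Measure.restrict_univ, hpi] using this

/-! ### Hypergeometric coefficients and convergence -/

/-- The rising factorial `x (x + 1) ⋯ (x + n - 1)` of a rational number. -/
def risingFac (x : ℚ) (n : ℕ) : ℚ := ∏ k ∈ Finset.range n, (x + k)

theorem risingFac_zero (x : ℚ) : risingFac x 0 = 1 := by simp [risingFac]

theorem risingFac_succ (x : ℚ) (n : ℕ) : risingFac x (n + 1) = risingFac x n * (x + n) := by
  simp [risingFac, Finset.prod_range_succ]

theorem risingFac_add (x : ℚ) (n m : ℕ) :
    risingFac x (n + m) = risingFac x m * risingFac (x + m) n := by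
  rw [risingFac, add_comm n m, Finset.prod_range_add]
  congr 1
  refine Finset.prod_congr rfl fun k _ => ?_
  push_cast
  ring

theorem risingFac_succ' (x : ℚ) (n : ℕ) : risingFac x (n + 1) = x * risingFac (x + 1) n := by
  rw [risingFac_add]
  simp [risingFac]

theorem risingFac_one (n : ℕ) : risingFac 1 n = n.factorial := by
  induction n with
  | zero => simp [risingFac]
  | succ n ih =>
    rw [risingFac_succ, ih, Nat.factorial_succ]
    push_cast
    ring

theorem risingFac_ne_zero {x : ℚ} (hx : ∀ m : ℕ, x ≠ -m) (n : ℕ) : risingFac x n ≠ 0 :=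
  Finset.prod_ne_zero_iff.2 fun k _ h => hx k (by linarith)

theorem eval_ascPochhammer_eq_risingFac (x : ℚ) (n : ℕ) :
    (ascPochhammer ℂ n).eval (x : ℂ) = risingFac x n := by
  induction n with
  | zero => simp [risingFac]
  | succ n ih =>
    rw [ascPochhammer_succ_eval, ih, risingFac_succ]
    push_cast
    rfl

theorem Ring.choose_eq_risingFac (c : ℚ) (n : ℕ) :
    Ring.choose ((c : ℂ) + n - 1) n = ((risingFac c n / n.factorial : ℚ) : ℂ) := by
  have h := Ring.factorial_nsmul_multichoose_eq_ascPochhammer (c : ℂ) n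
  rw [Ring.multichoose_eq, Polynomial.ascPochhammer_smeval_eq_eval, eval_ascPochhammer_eq_risingFac,
    nsmul_eq_mul] at h
  have hn : (n.factorial : ℂ) ≠ 0 := by exact_mod_cast n.factorial_ne_zero
  push_cast
  rw [← h]
  field_simp

theorem hasSum_one_sub_cpow (c : ℚ) {w : ℂ} (hw : ‖w‖ < 1) :
    HasSum (fun n : ℕ => ((risingFac c n / n.factorial : ℚ) : ℂ) * w ^ n)
      ((1 - w) ^ ((-c : ℚ) : ℂ)) := by
  have hmem : w ∈ Metric.eball (0 : ℂ) 1 := by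
    rw [mem_eball_zero_iff, ← ofReal_norm, ← ENNReal.ofReal_one]
    exact (ENNReal.ofReal_lt_ofReal_iff one_pos).2 hw
  have h := (Complex.one_div_one_sub_cpow_hasFPowerSeriesOnBall_zero (c : ℂ)).hasSum hmem
  simp only [FormalMultilinearSeries.ofScalars_apply_eq, smul_eq_mul, Ring.choose_eq_risingFac,
    zero_add] at h
  rw [one_div, ← Complex.cpow_neg, ← Rat.cast_neg] at h
  exact h

theorem tendsto_add_natCast_div (x y : ℚ) :
    Filter.Tendsto (fun n : ℕ => ((x : ℂ) + n) / (y + n)) Filter.atTop (nhds 1) := by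
  simpa using tendsto_add_mul_div_add_mul_atTop_nhds (x : ℂ) (y : ℂ) 1 one_ne_zero

/-- Coefficients of the hypergeometric series with parameters `(a i / b i)` and `c / 1`. -/
def hypCoeff {κ : Type} [Fintype κ] (a b : κ → ℚ) (c : ℚ) (n : ℕ) : ℚ :=
  (∏ i, risingFac (a i) n / risingFac (b i) n) * (risingFac c n / n.factorial)

theorem hypCoeff_succ {κ : Type} [Fintype κ] (a b : κ → ℚ) (c : ℚ) (n : ℕ) :
    hypCoeff a b c (n + 1) =
      hypCoeff a b c n * ((∏ i, (a i + n) / (b i + n)) * ((c + n) / (1 + n))) := by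
  simp only [hypCoeff, risingFac_succ, Nat.factorial_succ, mul_div_mul_comm,
    Finset.prod_mul_distrib]
  push_cast
  have hn : (n.factorial : ℚ) ≠ 0 := by exact_mod_cast n.factorial_ne_zero
  have hn' : (n : ℚ) + 1 ≠ 0 := by positivity
  have hn'' : (1 : ℚ) + n ≠ 0 := by positivity
  field_simp
  ring

/-- Ratio test: each factor (x + n) / (y + n) tends to 1, so the ratio of successive norms tends to
‖z‖. -/
theorem summable_norm_hypCoeff {κ : Type} [Fintype κ] (a b : κ → ℚ) (c : ℚ) {z : ℂ}
    (hz : ‖z‖ < 1) : Summable fun n => ‖(hypCoeff a b c n : ℂ) * z ^ n‖ := by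
  obtain ⟨r, hzr, hr⟩ := exists_between hz
  have ht : Filter.Tendsto (fun n : ℕ => ‖(∏ i, ((a i : ℂ) + n) / (b i + n)) *
      (((c : ℂ) + n) / ((1 : ℚ) + n)) * z‖) Filter.atTop (nhds ‖z‖) := by
    have := ((tendsto_finsetProd (Finset.univ : Finset κ) fun i _ =>
      tendsto_add_natCast_div (a i) (b i)).mul (tendsto_add_natCast_div c 1)).mul_const z |>.norm
    simpa using this
  refine summable_of_ratio_norm_eventually_le hr ?_
  filter_upwards [ht.eventually_le_const hzr] with n hn
  rw [norm_norm, norm_norm, hypCoeff_succ, pow_succ]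
  push_cast at hn ⊢
  rw [show ((hypCoeff a b c n : ℂ) * ((∏ i, ((a i : ℂ) + n) / (b i + n)) * ((c + n) / (1 + n)))) *
      (z ^ n * z) = ((∏ i, ((a i : ℂ) + n) / (b i + n)) * ((c + n) / (1 + n)) * z) *
      ((hypCoeff a b c n : ℂ) * z ^ n) by ring, norm_mul]
  gcongr

theorem summable_hypCoeff {κ : Type} [Fintype κ] (a b : κ → ℚ) (c : ℚ) {z : ℂ}
    (hz : ‖z‖ < 1) : Summable fun n => (hypCoeff a b c n : ℂ) * z ^ n :=
  (summable_norm_hypCoeff a b c hz).of_norm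

/-! ### Beta values and the Euler integral -/

open ProbabilityTheory in
theorem beta_add_one {α β : ℝ} (hα : 0 < α) (hβ : 0 < β) :
    beta (α + 1) β = beta α β * (α / (α + β)) := by
  have h1 : α + β ≠ 0 := by positivity
  have h2 : Real.Gamma (α + β) ≠ 0 := (Real.Gamma_pos_of_pos (by positivity)).ne'
  rw [beta, beta, Real.Gamma_add_one hα.ne', show α + 1 + β = α + β + 1 by ring,
    Real.Gamma_add_one h1]
  field_simp

-- Iterating Γ(x + 1) = x Γ(x) shows that the moments of the beta density produce the quotients of
-- rising factorials with lower parameter a + β.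
open ProbabilityTheory in
theorem beta_add_natCast {a β : ℚ} (ha : 0 < a) (hβ : 0 < β) (n : ℕ) :
    beta ((a : ℝ) + n) β = beta a β * ((risingFac a n / risingFac (a + β) n : ℚ) : ℝ) := by
  have ha' : (0 : ℝ) < a := by exact_mod_cast ha
  have hβ' : (0 : ℝ) < β := by exact_mod_cast hβ
  induction n with
  | zero => simp [risingFac_zero]
  | succ n ih =>
    push_cast at ih ⊢
    rw [← add_assoc, beta_add_one (by positivity) hβ', ih, risingFac_succ, risingFac_succ]
    push_cast
    rw [mul_div_mul_comm, mul_assoc, add_right_comm (a : ℝ) n β]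

/-- The density `t ^ (α - 1) * (1 - t) ^ (β - 1)` on the unit interval. -/
noncomputable def betaWeight (α β t : ℝ) : ℝ :=
  (Set.Ioo (0 : ℝ) 1).indicator (fun t => t ^ (α - 1) * (1 - t) ^ (β - 1)) t

theorem betaWeight_nonneg (α β t : ℝ) : 0 ≤ betaWeight α β t := by
  refine Set.indicator_nonneg (fun t ht => ?_) t
  have h1 : 0 < t := ht.1
  have h2 : 0 < 1 - t := by linarith [ht.2]
  positivity

theorem betaWeight_mul_pow (α β t : ℝ) (n : ℕ) :
    betaWeight α β t * t ^ n = betaWeight (α + n) β t := by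
  by_cases ht : t ∈ Set.Ioo (0 : ℝ) 1
  · simp only [betaWeight, Set.indicator_of_mem ht]
    rw [show α + n - 1 = (α - 1) + n by ring, Real.rpow_add_natCast ht.1.ne']
    ring
  · simp [betaWeight, Set.indicator_of_notMem ht]

open ProbabilityTheory in
theorem betaPDFReal_eq_betaWeight (α β t : ℝ) :
    betaPDFReal α β t = (1 / beta α β) * betaWeight α β t := by
  rw [betaPDFReal, betaWeight, Set.indicator_apply]
  by_cases ht : 0 < t ∧ t < 1
  · rw [if_pos ht, if_pos (show t ∈ Set.Ioo (0 : ℝ) 1 from ht), mul_assoc]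
  · rw [if_neg ht, if_neg (show t ∉ Set.Ioo (0 : ℝ) 1 from ht), mul_zero]

open ProbabilityTheory in
theorem integral_betaWeight {α β : ℝ} (hα : 0 < α) (hβ : 0 < β) :
    Integrable (betaWeight α β) ∧ ∫ t, betaWeight α β t = beta α β := by
  have h1 := lintegral_betaPDF_eq_one hα hβ
  simp only [betaPDF] at h1
  have hB := beta_pos hα hβ
  have hnn : ∀ t, 0 ≤ betaPDFReal α β t := fun t => by
    rw [betaPDFReal_eq_betaWeight]
    have := betaWeight_nonneg α β t
    positivity
  have hm := measurable_betaPDFReal α β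
  have hi : Integrable (betaPDFReal α β) := by
    refine ⟨hm.aestronglyMeasurable, ?_⟩
    rw [hasFiniteIntegral_iff_ofReal (.of_forall hnn), h1]
    exact ENNReal.one_lt_top
  have hI : ∫ t, betaPDFReal α β t = 1 := by
    rw [integral_eq_lintegral_of_nonneg_ae (.of_forall hnn) hm.aestronglyMeasurable, h1]
    rfl
  have heq : betaWeight α β = fun t => beta α β * betaPDFReal α β t := by
    funext t
    rw [betaPDFReal_eq_betaWeight]
    field_simp
  rw [heq]
  exact ⟨hi.const_mul _, by rw [integral_const_mul, hI, mul_one]⟩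

open ProbabilityTheory in
/-- The Euler integral: termwise integration of the binomial series. -/
theorem integral_euler_eq {κ : Type} [Fintype κ] {a β : κ → ℚ} (ha : ∀ i, 0 < a i)
    (hβ : ∀ i, 0 < β i) (c : ℚ) {z : ℂ} (hz : ‖z‖ < 1) :
    ∫ t : κ → ℝ, ((∏ i, betaWeight (a i) (β i) (t i) : ℝ) : ℂ) *
        (1 - z * (∏ i, t i : ℝ)) ^ ((-c : ℚ) : ℂ) =
      (∏ i, (beta (a i) (β i) : ℂ)) *
        ∑' n, (hypCoeff a (fun i => a i + β i) c n : ℂ) * z ^ n := by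
  have ha' : ∀ i, (0 : ℝ) < a i := fun i => by exact_mod_cast ha i
  have hβ' : ∀ i, (0 : ℝ) < β i := fun i => by exact_mod_cast hβ i
  set W : (κ → ℝ) → ℝ := fun t => ∏ i, betaWeight (a i) (β i) (t i) with hW
  have hWn : ∀ (n : ℕ) t, W t * (∏ i, t i) ^ n = ∏ i, betaWeight (a i + n) (β i) (t i) := by
    intro n t
    rw [hW, ← Finset.prod_pow, ← Finset.prod_mul_distrib]
    exact Finset.prod_congr rfl fun i _ => betaWeight_mul_pow _ _ _ _
  have hW0 : ∀ t, 0 ≤ W t := fun t => Finset.prod_nonneg fun i _ => betaWeight_nonneg _ _ _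
  have hint : ∀ n : ℕ, Integrable fun t => W t * (∏ i, t i) ^ n := fun n => by
    simp only [hWn]
    exact Integrable.fintype_prod fun i =>
      (integral_betaWeight (add_pos_of_pos_of_nonneg (ha' i) n.cast_nonneg) (hβ' i)).1
  have hval : ∀ n : ℕ, ∫ t, W t * (∏ i, t i) ^ n = (∏ i, beta (a i) (β i)) *
      ((∏ i, risingFac (a i) n / risingFac (a i + β i) n : ℚ) : ℝ) := fun n => by
    simp only [hWn]
    rw [integral_fintype_prod_volume_eq_prod]
    push_cast
    rw [← Finset.prod_mul_distrib]
    refine Finset.prod_congr rfl fun i _ => ?_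
    rw [(integral_betaWeight (add_pos_of_pos_of_nonneg (ha' i) n.cast_nonneg) (hβ' i)).2,
      beta_add_natCast (ha i) (hβ i)]
    push_cast
    rfl
  have hsupp : ∀ t, W t ≠ 0 → ∀ i, 0 < t i ∧ t i < 1 := by
    intro t ht i
    by_contra hi
    apply ht
    refine Finset.prod_eq_zero (Finset.mem_univ i) ?_
    exact Set.indicator_of_notMem (show t i ∉ Set.Ioo (0 : ℝ) 1 from hi) _
  have hT : ∀ t, W t ≠ 0 → 0 ≤ ∏ i, t i ∧ ∏ i, t i ≤ 1 := fun t ht =>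
    ⟨Finset.prod_nonneg fun i _ => (hsupp t ht i).1.le,
      Finset.prod_le_one (fun i _ => (hsupp t ht i).1.le) fun i _ => (hsupp t ht i).2.le⟩
  set F : ℕ → (κ → ℝ) → ℂ := fun n t => (((risingFac c n / n.factorial : ℚ) : ℂ) * z ^ n) *
    ((W t * (∏ i, t i) ^ n : ℝ) : ℂ) with hF
  have hFint : ∀ n, Integrable (F n) := fun n => (hint n).ofReal.const_mul _
  have hFval : ∀ n, ∫ t, F n t = (∏ i, (beta (a i) (β i) : ℂ)) *
      ((hypCoeff a (fun i => a i + β i) c n : ℂ) * z ^ n) := fun n => by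
    rw [hF]
    simp only
    rw [integral_const_mul, integral_complex_ofReal, hval, hypCoeff]
    push_cast
    ring
  -- Each F n is a complex constant times a nonnegative function, so the integral of its norm is the
  -- norm of its integral; the exchange of sum and integral then follows from absolute convergence
  -- of the series.
  have hFnorm : ∀ n, ∫ t, ‖F n t‖ = ‖(∏ i, (beta (a i) (β i) : ℂ))‖ *
      ‖(hypCoeff a (fun i => a i + β i) c n : ℂ) * z ^ n‖ := fun n => by
    rw [← norm_mul, ← hFval]
    have h1 : ∀ t, ‖F n t‖ = ‖((risingFac c n / n.factorial : ℚ) : ℂ) * z ^ n‖ *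
        (W t * (∏ i, t i) ^ n) := fun t => by
      rw [hF]
      simp only
      rw [norm_mul, Complex.norm_real, Real.norm_of_nonneg]
      by_cases ht : W t = 0
      · simp [ht]
      · exact mul_nonneg (hW0 t) (pow_nonneg (hT t ht).1 n)
    simp only [h1]
    rw [hF]
    simp only
    rw [integral_const_mul, integral_const_mul, integral_complex_ofReal,
      norm_mul _ (Complex.ofReal _), Complex.norm_real, Real.norm_of_nonneg]
    refine integral_nonneg fun t => ?_
    by_cases ht : W t = 0
    · simp [ht]
    · exact mul_nonneg (hW0 t) (pow_nonneg (hT t ht).1 n)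
  have hsum := hasSum_integral_of_summable_integral_norm hFint (by
    simp only [hFnorm]
    exact (summable_norm_hypCoeff _ _ c hz).mul_left _)
  simp only [hFval] at hsum
  rw [← tsum_mul_left, hsum.tsum_eq]
  refine integral_congr_ae (.of_forall fun t => ?_)
  by_cases ht : W t = 0
  · change ((W t : ℝ) : ℂ) * _ = ∑' n, F n t
    simp only [hF, ht]
    simp
  · have hlt : ‖z * (∏ i, t i : ℝ)‖ < 1 := by
      rw [norm_mul, Complex.norm_real, Real.norm_of_nonneg (hT t ht).1]
      nlinarith [(hT t ht).2, (hT t ht).1, norm_nonneg z]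
    have h := ((hasSum_one_sub_cpow c hlt).mul_left ((W t : ℝ) : ℂ)).tsum_eq
    beta_reduce
    rw [← h]
    refine tsum_congr fun n => ?_
    rw [hF, mul_pow]
    push_cast
    ring

open ProbabilityTheory in
theorem isVolumeDiffC_euler {κ : Type} [Fintype κ] {a β : κ → ℚ} (ha : ∀ i, 0 < a i)
    (hβ : ∀ i, 0 < β i) (c : ℚ) {z : ℂ} (hz : IsAlgebraic ℚ z) (hz1 : ‖z‖ < 1) :
    IsVolumeDiffC ((∏ i, (beta (a i) (β i) : ℂ)) *
      ∑' n, (hypCoeff a (fun i => a i + β i) c n : ℂ) * z ^ n) := by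
  rw [← integral_euler_eq ha hβ c hz1]
  set S : Set (κ → ℝ) := {t | ∀ i, 0 < t i ∧ t i < 1} with hS
  have hSs : SemialgQ S := .unitCube
  have hnice : NiceC S (fun t : κ → ℝ => (1 - z * (∏ i, t i : ℝ)) ^ ((-c : ℚ) : ℂ)) := by
    refine (NiceC.one_sub_cpow (Complex.isAlgebraic_re_im hz).1 (Complex.isAlgebraic_re_im hz).2
      hz1 (-c)).comp (φ := fun t _ => ∏ i, t i) (fun _ => .prod _ fun i _ => .coord i) ?_
    intro t ht
    exact ⟨Finset.prod_pos fun i _ => (ht i).1,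
      Finset.prod_le_one (fun i _ => (ht i).1.le) fun i _ => (ht i).2.le⟩
  -- The beta density enters as the weight, since it can blow up at the faces of the cube; on the
  -- open cube g equals it, and only its total mass matters.
  set g : (κ → ℝ) → ℝ≥0∞ := fun t => ∏ i,
    (ENNReal.ofReal (if 0 < t i then t i ^ ((a i - 1 : ℚ) : ℝ) else 0) *
      ENNReal.ofReal (if 0 < 1 - t i then (1 - t i) ^ ((β i - 1 : ℚ) : ℝ) else 0)) with hg
  have hgv : IsVolumeFun g := .prod _ fun i =>
    (IsVolumeFun.ofReal_rpow (.coord i) _).mul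
      (.ofReal_rpow (IsPolyFun.one.sub (.coord i)) _)
  have hgW : ∀ t ∈ S, g t = ENNReal.ofReal (∏ i, betaWeight (a i) (β i) (t i)) := by
    intro t ht
    rw [ENNReal.ofReal_prod_of_nonneg fun i _ => betaWeight_nonneg _ _ _]
    refine Finset.prod_congr rfl fun i _ => ?_
    have h1 : 0 < 1 - t i := by linarith [(ht i).2]
    rw [if_pos (ht i).1, if_pos h1, ← ENNReal.ofReal_mul (Real.rpow_nonneg (ht i).1.le _),
      betaWeight, Set.indicator_of_mem (show t i ∈ Set.Ioo (0 : ℝ) 1 from ht i)]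
    push_cast
    rfl
  have hint : Integrable fun t : κ → ℝ => ∏ i, betaWeight (a i) (β i) (t i) :=
    Integrable.fintype_prod fun i =>
      (integral_betaWeight (by exact_mod_cast ha i) (by exact_mod_cast hβ i)).1
  have hfin : ∫⁻ t in S, g t ≠ ∞ := by
    rw [setLIntegral_congr_fun hSs.measurableSet hgW]
    exact hint.integrableOn.lintegral_lt_top.ne
  have := NiceC.isVolumeDiffC_setIntegral hSs hnice hgv hfin
  rw [← setIntegral_eq_integral_of_forall_compl_eq_zero (s := S)]
  · convert this using 1
    refine setIntegral_congr_fun hSs.measurableSet fun t ht => ?_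
    rw [hgW t ht, ENNReal.toReal_ofReal (Finset.prod_nonneg fun i _ => betaWeight_nonneg _ _ _)]
  · intro t ht
    have hW : ∏ i, betaWeight (a i) (β i) (t i) = 0 := by
      simp only [hS, Set.mem_ofPred_eq, not_forall] at ht
      obtain ⟨i, hi⟩ := ht
      exact Finset.prod_eq_zero (Finset.mem_univ i)
        (Set.indicator_of_notMem (show t i ∉ Set.Ioo (0 : ℝ) 1 from hi) _)
    rw [hW]
    simp

-- The Euler integral at z = 0, where only the constant term of the series survives.
open ProbabilityTheory in
theorem isVolumeDiffC_beta {a β : ℚ} (ha : 0 < a) (hβ : 0 < β) :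
    IsVolumeDiffC (beta a β : ℂ) := by
  have h := isVolumeDiffC_euler (κ := Unit) (a := fun _ => a) (β := fun _ => β) (fun _ => ha)
    (fun _ => hβ) 0 (z := 0) isAlgebraic_zero (by simp)
  rw [tsum_eq_single 0 (fun n hn => by simp [hn])] at h
  simpa [hypCoeff, risingFac_zero] using h

open ProbabilityTheory in
/-- Reciprocals of beta values lie in `π⁻¹ 𝒫`. -/
theorem isVolumeDiffC_pi_div_beta {a β : ℚ} (ha : 0 < a) (hβ : 0 < β) :
    IsVolumeDiffC (Real.pi / beta a β : ℂ) := by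
  have hβ' : (0 : ℝ) < β := by exact_mod_cast hβ
  -- Induction on an integer bound for a: the recursion for B(a + 1, β) lowers a by 1 at the cost of
  -- a rational factor, until a ≤ 1.
  obtain ⟨N, hN⟩ := exists_nat_gt a
  induction N generalizing a with
  | zero => exact absurd ha (by simpa using hN.le)
  | succ N ih =>
    have ha' : (0 : ℝ) < a := by exact_mod_cast ha
    have hπ := IsVolumeDiffC.ofReal isVolumeDiff_pi
    have hGβ := Real.Gamma_pos_of_pos hβ'
    rcases lt_trichotomy a 1 with h1 | rfl | h1
    · have h1' : (a : ℝ) < 1 := by exact_mod_cast h1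
      have hsin : 0 < Real.sin (Real.pi * a) := Real.sin_pos_of_pos_of_lt_pi
        (by positivity) (by nlinarith [Real.pi_pos])
      have hGa := Real.Gamma_pos_of_pos ha'
      have hG1 : 0 < Real.Gamma (1 - a) := Real.Gamma_pos_of_pos (by linarith)
      have hGab : 0 < Real.Gamma (a + β) := Real.Gamma_pos_of_pos (by positivity)
      -- The reflection formula for Γ(a) Γ(1 - a), together with Γ(β + 1) = β Γ(β), turns the
      -- reciprocal beta value into an algebraic number times another beta value with positive
      -- arguments.
      have key : Real.pi / beta a β = Real.sin (a * Real.pi) * β * beta (a + β) (1 - a) := by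
        have hrefl := Real.Gamma_mul_Gamma_one_sub (a : ℝ)
        rw [eq_div_iff hsin.ne'] at hrefl
        rw [beta, beta, show (a : ℝ) + β + (1 - a) = β + 1 by ring, Real.Gamma_add_one hβ'.ne',
          mul_comm (a : ℝ) Real.pi]
        generalize Real.sin (Real.pi * a) = s at hrefl
        rw [← hrefl]
        field_simp
      have hs : IsVolumeDiffC (Real.sin (a * Real.pi) : ℂ) := by
        refine .algebraic ?_
        have h2 : IsAlgebraic ℚ (Complex.sin (a * Real.pi)) :=
          (Complex.isAlgebraic_sin_rat_mul_pi a).extendScalars (S := ℚ)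
            (algebraMap ℤ ℚ).injective_int
        simpa using h2
      have hb := isVolumeDiffC_beta (a := a + β) (β := 1 - a) (by positivity) (by linarith)
      have := (hs.mul (.ratCast β)).mul hb
      rw [← Complex.ofReal_div, key]
      push_cast at this ⊢
      exact this
    · have key : Real.pi / beta 1 β = Real.pi * β := by
        rw [beta, Real.Gamma_one, add_comm, Real.Gamma_add_one hβ'.ne']
        field_simp
      rw [← Complex.ofReal_div]
      push_cast
      rw [← Complex.ofReal_div, key]
      simpa using hπ.mul (.ratCast β)
    · have hi := ih (a := a - 1) (by linarith) (by push_cast at hN; linarith)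
      have h1' : (0 : ℝ) < (a : ℝ) - 1 := by
        have : (1 : ℝ) < a := by exact_mod_cast h1
        linarith
      have key : Real.pi / beta a β =
          Real.pi / beta (a - 1) β * (((a - 1 + β) / (a - 1) : ℚ) : ℝ) := by
        have h := beta_add_one h1' hβ'
        rw [sub_add_cancel] at h
        have hB := beta_pos h1' hβ'
        rw [h]
        push_cast
        field_simp
      have := hi.mul (.ratCast ((a - 1 + β) / (a - 1)))
      rw [← Complex.ofReal_div, key]
      push_cast at this ⊢
      exact this

/-! ### Reduction of general parameters to the Euler case -/

/-- The sum of the hypergeometric series. -/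
noncomputable def hypSum {κ : Type} [Fintype κ] (a b : κ → ℚ) (c : ℚ) (z : ℂ) : ℂ :=
  ∑' n, (hypCoeff a b c n : ℂ) * z ^ n

/-- Every rising factorial splits off its first m factors. The factorial (n + m)! leaves (1 + m)_n
instead of n!, which is repaired by the extra pair (1, 1 + m), indexed by `none`. -/
theorem hypCoeff_add {κ : Type} [Fintype κ] (a b : κ → ℚ) (c : ℚ) (m n : ℕ) :
    hypCoeff a b c (n + m) = hypCoeff a b c m *
      hypCoeff (fun i : Option κ => i.elim 1 fun i => a i + m)
        (fun i : Option κ => i.elim (1 + m : ℚ) fun i => b i + m) (c + m) n := by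
  have hf : (((n + m).factorial : ℕ) : ℚ) = m.factorial * risingFac (1 + m) n := by
    rw [← risingFac_one, ← risingFac_one, risingFac_add]
  have hn : (n.factorial : ℚ) ≠ 0 := by exact_mod_cast n.factorial_ne_zero
  simp only [hypCoeff, Fintype.prod_option, Option.elim, risingFac_add _ n m, mul_div_mul_comm,
    Finset.prod_mul_distrib, hf, risingFac_one]
  field_simp

open ProbabilityTheory in
/-- The case `0 < b i - a i`: a tail of the series is an Euler integral. -/
theorem isVolumeDiffC_hypSum_of_lt {κ : Type} [Fintype κ] {a b : κ → ℚ} (h : ∀ i, a i < b i)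
    (c : ℚ) {z : ℂ} (hz : IsAlgebraic ℚ z) (hz1 : ‖z‖ < 1) :
    IsVolumeDiffC ((Real.pi : ℂ) ^ Fintype.card κ * hypSum a b c z) := by
  -- The shift m makes all upper parameters positive; m > 0 is needed so that the extra pair (1, 1 +
  -- m) also has positive difference m.
  obtain ⟨m, hm1, hm⟩ : ∃ m : ℕ, 0 < m ∧ ∀ i, 0 < a i + m := by
    choose k hk using fun i => exists_nat_gt (-a i)
    refine ⟨∑ i, k i + 1, by positivity, fun i => ?_⟩
    have h1 : (k i : ℚ) ≤ ∑ j, (k j : ℚ) :=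
      Finset.single_le_sum (f := fun j => (k j : ℚ)) (fun j _ => by positivity) (Finset.mem_univ i)
    have := hk i
    push_cast
    linarith
  have hm1' : (0 : ℚ) < m := by exact_mod_cast hm1
  have hπ : IsVolumeDiffC ((Real.pi : ℂ) ^ Fintype.card κ) :=
    (IsVolumeDiffC.ofReal isVolumeDiff_pi).pow _
  have hzv : IsVolumeDiffC z := .algebraic hz
  set a' : Option κ → ℚ := fun i => i.elim 1 fun i => a i + m with ha'
  set β' : Option κ → ℚ := fun i => i.elim (m : ℚ) fun i => b i - a i with hβ'
  have hb' : (fun i => a' i + β' i) = fun i : Option κ => i.elim (1 + m : ℚ) fun i => b i + m := by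
    funext i
    cases i <;> simp [ha', hβ'] <;> ring
  have hapos : ∀ i, 0 < a' i := by
    rintro (_ | i)
    · exact one_pos
    · exact hm i
  have hβpos : ∀ i, 0 < β' i := by
    rintro (_ | i)
    · exact hm1'
    · exact sub_pos.2 (h i)
  have heuler := isVolumeDiffC_euler hapos hβpos (c + m) hz hz1
  have hprod : IsVolumeDiffC (∏ i, (Real.pi / beta (a' (some i)) (β' (some i)) : ℂ)) :=
    .prod _ fun i _ => isVolumeDiffC_pi_div_beta (hapos _) (hβpos _)
  -- The extra pair has the rational beta value 1 / m, so it costs no additional power of π.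
  have hnone : (beta (a' none) (β' none) : ℂ) = ((m⁻¹ : ℚ) : ℂ) := by
    have hm' : (m : ℝ) ≠ 0 := by exact_mod_cast hm1.ne'
    have hg : Real.Gamma m ≠ 0 := (Real.Gamma_pos_of_pos (by exact_mod_cast hm1)).ne'
    have : beta 1 (m : ℝ) = (m : ℝ)⁻¹ := by
      rw [beta, Real.Gamma_one, add_comm, Real.Gamma_add_one hm']
      field_simp
    simp only [ha', hβ', Option.elim, Rat.cast_one, Rat.cast_natCast, this]
    push_cast
    rfl
  have htail : (Real.pi : ℂ) ^ Fintype.card κ * hypSum a' (fun i => a' i + β' i) (c + m) z =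
      ((m : ℚ) : ℂ) * ((∏ i, (Real.pi / beta (a' (some i)) (β' (some i)) : ℂ)) *
      ((∏ i, (beta (a' i) (β' i) : ℂ)) *
        ∑' n, (hypCoeff a' (fun i => a' i + β' i) (c + m) n : ℂ) * z ^ n)) := by
    have hB : ∀ i, (beta (a' (some i)) (β' (some i)) : ℂ) ≠ 0 := fun i => by
      have := beta_pos (α := a' (some i)) (β := β' (some i)) (by exact_mod_cast hapos _)
        (by exact_mod_cast hβpos _)
      exact_mod_cast this.ne'
    have hm' : (m : ℂ) ≠ 0 := by exact_mod_cast hm1.ne'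
    have hP : ∏ i, (beta (a' (some i)) (β' (some i)) : ℂ) ≠ 0 :=
      Finset.prod_ne_zero_iff.2 fun i _ => hB i
    rw [Fintype.prod_option, hnone, Finset.prod_div_distrib, Finset.prod_const, Finset.card_univ,
      hypSum]
    push_cast
    field_simp
  have hsplit : hypSum a b c z = ∑ n ∈ Finset.range m, (hypCoeff a b c n : ℂ) * z ^ n +
      ((hypCoeff a b c m : ℂ) * z ^ m) * hypSum a' (fun i => a' i + β' i) (c + m) z := by
    rw [hypSum, ← (summable_hypCoeff a b c hz1).sum_add_tsum_nat_add m, hypSum,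
      ← tsum_mul_left, hb']
    congr 1
    refine tsum_congr fun n => ?_
    rw [hypCoeff_add, pow_add]
    push_cast
    ring
  rw [hsplit, mul_add, mul_left_comm, htail]
  refine (hπ.mul (.sum _ fun n _ => ?_)).add (.mul ?_ (.mul (.ratCast _) (hprod.mul heuler)))
  · exact (IsVolumeDiffC.ratCast _).mul (hzv.pow _)
  · exact (IsVolumeDiffC.ratCast _).mul (hzv.pow _)

/-- Coefficient form of the fact that differentiating the series shifts all parameters by one. -/
theorem natCast_mul_hypCoeff_succ {κ : Type} [Fintype κ] (a b : κ → ℚ) (c : ℚ) (n : ℕ) :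
    ((n + 1 : ℕ) : ℚ) * hypCoeff a b c (n + 1) =
      ((∏ i, a i / b i) * c) * hypCoeff (fun i => a i + 1) (fun i => b i + 1) (c + 1) n := by
  have hn : (n.factorial : ℚ) ≠ 0 := by exact_mod_cast n.factorial_ne_zero
  have hn' : (n : ℚ) + 1 ≠ 0 := by positivity
  simp only [hypCoeff, risingFac_succ', mul_div_mul_comm, Finset.prod_mul_distrib,
    Nat.factorial_succ]
  push_cast
  field_simp

/-- A contiguity relation raising one of the lower parameters. -/
theorem hypSum_update {κ : Type} [Fintype κ] [DecidableEq κ] (a b : κ → ℚ) (c : ℚ) (j : κ)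
    (hb : ∀ (i : κ) (m : ℕ), b i ≠ -m) {z : ℂ} (hz1 : ‖z‖ < 1) :
    hypSum a b c z = hypSum a (Function.update b j (b j + 1)) c z +
      (((b j)⁻¹ * ((∏ i, a i / Function.update b j (b j + 1) i) * c) : ℚ) : ℂ) * z *
      hypSum (fun i => a i + 1) (fun i => Function.update b j (b j + 1) i + 1) (c + 1) z := by
  set b' := Function.update b j (b j + 1) with hb'
  have hb0 : b j ≠ 0 := by simpa using hb j 0
  -- From 1 / (b)_n = (1 + n / b) / (b + 1)_n. The factor n then acts as z d/dz, which gives the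
  -- series with shifted parameters.
  have hcoef : ∀ n, hypCoeff a b c n = hypCoeff a b' c n * (1 + (b j)⁻¹ * n) := by
    intro n
    have hr : ∀ i, (risingFac (b i) n)⁻¹ = (risingFac (b' i) n)⁻¹ *
        if i = j then 1 + (b j)⁻¹ * n else 1 := by
      intro i
      by_cases hi : i = j
      · subst hi
        rw [if_pos rfl, hb', Function.update_self]
        have h1 := risingFac_succ' (b i) n
        rw [risingFac_succ] at h1
        have h2 := risingFac_ne_zero (hb i) n
        have h3 : risingFac (b i + 1) n ≠ 0 := risingFac_ne_zero (fun m hm => hb i (m + 1) (by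
          push_cast
          linarith)) n
        field_simp
        linarith
      · rw [if_neg hi, mul_one, hb', Function.update_of_ne hi]
    simp only [hypCoeff, div_eq_mul_inv _ (risingFac (b _) n), hr]
    simp only [← mul_assoc, Finset.prod_mul_distrib, Finset.prod_ite_eq', Finset.mem_univ, if_true,
      div_eq_mul_inv]
    ring
  have hs := summable_hypCoeff a b' c hz1
  have hs' : Summable fun n : ℕ => (((b j)⁻¹ * (n * hypCoeff a b' c n) : ℚ) : ℂ) * z ^ n := by
    have := (summable_hypCoeff a b c hz1).sub hs
    refine this.congr fun n => ?_
    rw [hcoef]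
    push_cast
    ring
  have hsum : hypSum a b c z = hypSum a b' c z +
      ∑' n : ℕ, (((b j)⁻¹ * (n * hypCoeff a b' c n) : ℚ) : ℂ) * z ^ n := by
    rw [hypSum, hypSum, ← hs.tsum_add hs']
    refine tsum_congr fun n => ?_
    rw [hcoef]
    push_cast
    ring
  rw [hsum, hs'.tsum_eq_zero_add, hypSum, hypSum, ← tsum_mul_left]
  congr 1
  simp only [Nat.cast_zero, zero_mul, mul_zero, Rat.cast_zero, zero_add]
  refine tsum_congr fun n => ?_
  rw [natCast_mul_hypCoeff_succ, pow_succ]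
  push_cast
  ring

theorem isVolumeDiffC_hypSum {κ : Type} [Fintype κ] {a b : κ → ℚ}
    (hb : ∀ (i : κ) (m : ℕ), b i ≠ -m) (c : ℚ) {z : ℂ} (hz : IsAlgebraic ℚ z) (hz1 : ‖z‖ < 1) :
    IsVolumeDiffC ((Real.pi : ℂ) ^ Fintype.card κ * hypSum a b c z) := by
  classical
  -- Here k i bounds by how much a i may exceed b i, and the induction is on the total of the k i.
  -- All parameters are generalized because the contiguity relation changes them.
  suffices H : ∀ (K : ℕ) (k : κ → ℕ), ∑ i, k i = K → ∀ (a b : κ → ℚ) (c : ℚ),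
      (∀ (i : κ) (m : ℕ), b i ≠ -m) → (∀ i, a i < b i + k i) →
      IsVolumeDiffC ((Real.pi : ℂ) ^ Fintype.card κ * hypSum a b c z) by
    choose k hk using fun i => exists_nat_gt (a i - b i)
    exact H _ k rfl a b c hb fun i => by linarith [hk i]
  intro K
  induction K with
  | zero =>
    intro k hk a b c hb h
    have hk0 : ∀ i, k i = 0 := by simpa using hk
    exact isVolumeDiffC_hypSum_of_lt (fun i => by simpa [hk0] using h i) c hz hz1
  | succ K ih =>
    intro k hk a b c hb h
    obtain ⟨j, -, hj⟩ : ∃ j ∈ Finset.univ, k j ≠ 0 := by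
      by_contra! h'
      rw [Finset.sum_eq_zero h'] at hk
      omega
    obtain ⟨l, hl⟩ := Nat.exists_eq_succ_of_ne_zero hj
    have hK : ∑ i, Function.update k j l i = K := by
      have h1 := Finset.sum_update_of_mem (Finset.mem_univ j) k l
      have h2 := Finset.add_sum_erase Finset.univ k (Finset.mem_univ j)
      rw [Finset.sdiff_singleton_eq_erase] at h1
      omega
    have hb' : ∀ (i : κ) (m : ℕ), Function.update b j (b j + 1) i ≠ -m := by
      intro i m
      by_cases hi : i = j
      · subst hi
        rw [Function.update_self]
        intro h
        exact hb i (m + 1) (by push_cast; linarith)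
      · rw [Function.update_of_ne hi]
        exact hb i m
    have hlt : ∀ i, a i < Function.update b j (b j + 1) i + Function.update k j l i := by
      intro i
      have := h i
      by_cases hi : i = j
      · subst hi
        rw [hl] at this
        simp only [Function.update_self]
        push_cast at this
        linarith
      · simpa only [Function.update_of_ne hi] using this
    -- Both series on the right have total K: the first has b j raised by 1, and the second shifts
    -- all of its parameters by 1, which preserves the differences.
    rw [hypSum_update a b c j hb hz1, mul_add, mul_left_comm]
    refine (ih _ hK _ _ _ hb' hlt).add (((IsVolumeDiffC.ratCast _).mul (.algebraic hz)).mul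
      (ih _ hK _ _ _ (fun i m hm => ?_) fun i => ?_))
    · exact hb' i (m + 1) (by push_cast; linarith)
    · linarith [hlt i]

/-- The first q upper parameters are paired with the lower ones, and the last is paired with n!,
becoming the binomial exponent c. -/
theorem genHypergeometricTerm_eq {q : ℕ} (a : Fin (q + 1) → ℚ) (b : Fin q → ℚ) (z : ℂ) (n : ℕ) :
    genHypergeometricTerm (fun i => (a i : ℂ)) (fun j => (b j : ℂ)) z n =
      (hypCoeff (fun i => a i.castSucc) b (a (Fin.last q)) n : ℂ) * z ^ n := by
  rw [genHypergeometricTerm, Fin.prod_univ_castSucc, hypCoeff]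
  simp only [eval_ascPochhammer_eq_risingFac, Finset.prod_div_distrib]
  push_cast
  ring

theorem mainTheorem2 (p : ℕ) (hp : 2 ≤ p) (a : Fin p → ℚ) (b : Fin (p - 1) → ℚ)
    (hb : ∀ (j : Fin (p - 1)) (m : ℕ), b j ≠ -(m : ℚ))
    (z : ℂ) (hz : IsAlgebraic ℚ z) (hz1 : ‖z‖ < 1) :
    Summable (genHypergeometricTerm (fun i => (a i : ℂ)) (fun j => (b j : ℂ)) z) ∧
    ∃ w ∈ kzPeriods,
      genHypergeometric (fun i => (a i : ℂ)) (fun j => (b j : ℂ)) z =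
        w / (Real.pi : ℂ) ^ (p - 1) := by
  obtain ⟨q, rfl⟩ : ∃ q, p = q + 1 := ⟨p - 1, by omega⟩
  have hterm := genHypergeometricTerm_eq (q := q) a b z
  constructor
  · refine (summable_hypCoeff (fun i => a i.castSucc) b (a (Fin.last q)) hz1).congr fun n => ?_
    exact (hterm n).symm
  · have hmem := isVolumeDiffC_hypSum (a := fun i : Fin q => a i.castSucc) hb
      (a (Fin.last q)) hz hz1
    refine ⟨_, hmem.mem_kzPeriods, ?_⟩
    have hπ : (Real.pi : ℂ) ≠ 0 := by exact_mod_cast Real.pi_ne_zero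
    rw [Fintype.card_fin]
    change _ = (Real.pi : ℂ) ^ q * _ / (Real.pi : ℂ) ^ q
    rw [mul_div_cancel_left₀ _ (pow_ne_zero _ hπ)]
    exact tsum_congr hterm
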